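/- **Setting.** All vectors are real, $'$ denotes transpose, and for a symmetric matrix $X$ we write $X^{-1}$ for its Moore–Penrose pseudoinverse and $\det X$ for its pseudo-determinant (the product of its nonzero eigenvalues with multiplicity, equal to $1$ if there are none). For symmetric matrices, $X\succeq Y$ means that $X-Y$ is positive semidefinite. *Plant.* Let $x_{k+1}=Ax_k+w_k$, $y_k=Cx_k+v_k$ ($k\ge 0$, $x_k\in\mathbb R^n$, $y_k\in\mathbb R^m$), where $x_0\sim\mathcal N(0,\Pi_0)$ with $\Pi_0\succeq0$, the $w_k$ are i.i.d. $\mathcal N(0,Q)$ with $Q\succeq 0$, the $v_k$ are i.i.d. $\mathcal N(0,R)$ with $R\succ0$, and $x_0$, $(w_k)_k$, $(v_k)_k$ are mutually independent. *Sensor.* Let $\hat x_k^s=\mathbb E[x_k\mid y_1,\dots,y_k]$ (so $\hat x_0^s=\mathbb E[x_0]$), and assume that the local filter is in steady state: there is a constant matrix $\overline P$ with $\mathbb E[(x_k-\hat x_k^s)(x_k-\hat x_k^s)'\mid y_1,\dots,y_k]=\overline P$ almost surely for all $k\ge0$. Put $h(X)=AXA'+Q$. *Controller.* Let $\gamma_k\in\{0,1\}$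 be the indicator that $\hat x^s_k$ is received, with $\gamma_0=1$. For $k\ge1$ let $$\tau(k)=k-\max\{0\le t\le k-1:\gamma_t=1\},\qquad \varepsilon_k=\hat x_k^s-A^{\tau(k)}\hat x^s_{k-\tau(k)}.$$ Fix constants $N_0,W>0$, $\alpha\in(0,1]$, $\omega\ge0$ and weights $\mathcal Q_\tau\succeq0$ ($\tau\ge1$). The controller $\theta_{\rm ef}$ uses the transmission power $$\omega_k=\frac{N_0W}{2\alpha}\,\varepsilon_k'\mathcal Q_{\tau(k)}\varepsilon_k+\omega .$$ *Channel.* For every $k\ge1$, conditionally on $x_0$, on the whole sequences $(w_j)_j,(v_j)_j$ and on $\gamma_0,\dots,\gamma_{k-1}$, the event $\gamma_k=0$ has probability $q^{\omega_k}$, where $q=\exp(-\alpha/(N_0W))$. *Matrices.* Let $\Psi_0=0$ and, for $\tau\ge1$, $$\Sigma_\tau=A\Psi_{\tau-1}A'+h(\overline P)-\overline P,\qquad \Psi_\tau=(\mathcal Q_\tau+\Sigma_\tau^{-1})^{-1},$$ and assume that the weights are chosen so that $\Sigma_\tau\succeq\Psi_\tau$ for all $\tau\ge1$. *Information.* Let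 $\mathrm I_k$ be the information $\{\gamma_1\hat x_1^s,\dots,\gamma_k\hat x^s_k\}\cup\{\gamma_1,\dots,\gamma_k\}$ of the remote estimator. **Claim.** Under $\theta_{\rm ef}$, for every $k\ge1$, almost surely, with $\tau=\tau(k)$, $$\Pr(\gamma_k=0\mid \mathrm I_{k-1})=\frac{1}{\sqrt{\det(\Sigma_\tau)\,\det(\Psi_\tau^{-1})}}\,\exp\!\Big(-\frac{\alpha}{N_0W}\,\omega\Big).$$ -/

import Mathlib

open MeasureTheory ProbabilityTheory Matrix
open scoped ENNReal NNReal

namespace RemoteEstimation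

/-! ### Pseudoinverse and pseudo-determinant -/

section PseudoInverse

variable {n : ℕ}

/-- `X` is a Moore–Penrose pseudoinverse of the real square matrix `M`: the four Penrose
equations. -/
structure IsMoorePenrose (M X : Matrix (Fin n) (Fin n) ℝ) : Prop where
  mul_inv_mul : M * X * M = M
  inv_mul_inv : X * M * X = X
  symm_left : (M * X)ᵀ = M * X
  symm_right : (X * M)ᵀ = X * M

/-- A Moore–Penrose pseudoinverse is unique. -/
theorem IsMoorePenrose.unique {M X Y : Matrix (Fin n) (Fin n) ℝ}
    (hX : IsMoorePenrose M X) (hY : IsMoorePenrose M Y) : X = Y := by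
  have h1 : M * X = M * Y := by
    calc M * X = (M * X)ᵀ := hX.symm_left.symm
      _ = ((M * Y * M) * X)ᵀ := by rw [hY.mul_inv_mul]
      _ = ((M * Y) * (M * X))ᵀ := by simp only [Matrix.mul_assoc]
      _ = (M * X) * (M * Y) := by rw [transpose_mul, hX.symm_left, hY.symm_left]
      _ = (M * X * M) * Y := by simp only [Matrix.mul_assoc]
      _ = M * Y := by rw [hX.mul_inv_mul]
  have h2 : X * M = Y * M := by
    calc X * M = (X * M)ᵀ := hX.symm_right.symm
      _ = (X * (M * Y * M))ᵀ := by rw [hY.mul_inv_mul]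
      _ = ((X * M) * (Y * M))ᵀ := by simp only [Matrix.mul_assoc]
      _ = (Y * M) * (X * M) := by rw [transpose_mul, hX.symm_right, hY.symm_right]
      _ = Y * (M * X * M) := by simp only [Matrix.mul_assoc]
      _ = Y * M := by rw [hX.mul_inv_mul]
  calc X = X * M * X := hX.inv_mul_inv.symm
    _ = Y * (M * X) := by rw [h2, Matrix.mul_assoc]
    _ = Y * M * Y := by rw [h1, Matrix.mul_assoc]
    _ = Y := hY.inv_mul_inv

/-- A symmetric matrix has a symmetric Moore–Penrose pseudoinverse. -/
theorem exists_isMoorePenrose_of_isHermitian {M : Matrix (Fin n) (Fin n) ℝ}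
    (hM : M.IsHermitian) : ∃ X, IsMoorePenrose M X ∧ Xᵀ = X := by
  obtain ⟨U, V, d, hUV, hV, hMd⟩ : ∃ (U V : Matrix (Fin n) (Fin n) ℝ) (d : Fin n → ℝ),
      V * U = 1 ∧ V = Uᵀ ∧ M = U * diagonal d * V := by
    refine ⟨hM.eigenvectorUnitary, star (hM.eigenvectorUnitary : Matrix (Fin n) (Fin n) ℝ),
      hM.eigenvalues, ?_, ?_, ?_⟩
    · exact Unitary.coe_star_mul_self hM.eigenvectorUnitary
    · rw [star_eq_conjTranspose, conjTranspose_eq_transpose_of_trivial]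
    · have h := hM.spectral_theorem
      rw [Unitary.conjStarAlgAut_apply] at h
      exact h
  have key : ∀ a b : Fin n → ℝ, (U * diagonal a * V) * (U * diagonal b * V)
      = U * diagonal (fun i => a i * b i) * V := by
    intro a b
    calc (U * diagonal a * V) * (U * diagonal b * V)
        = U * diagonal a * (V * U) * (diagonal b * V) := by simp only [Matrix.mul_assoc]
      _ = U * (diagonal a * diagonal b) * V := by
          rw [hUV, Matrix.mul_one]; simp only [Matrix.mul_assoc]
      _ = _ := by rw [diagonal_mul_diagonal]
  have symm : ∀ a : Fin n → ℝ, (U * diagonal a * V)ᵀ = U * diagonal a * V := by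
    intro a
    rw [hV]
    simp [transpose_mul, Matrix.mul_assoc]
  refine ⟨U * diagonal (fun i => (d i)⁻¹) * V, ⟨?_, ?_, ?_, ?_⟩, symm _⟩
  · rw [hMd, key, key]
    simp only [mul_inv_mul_cancel]
  · rw [hMd, key, key]
    have : ∀ x : ℝ, x⁻¹ * x * x⁻¹ = x⁻¹ := fun x => by
      by_cases hx : x = 0 <;> simp [hx]
    simp only [this]
  · rw [hMd, key, symm]
  · rw [hMd, key, symm]

/-- Every real square matrix has a Moore–Penrose pseudoinverse. -/
theorem exists_isMoorePenrose (M : Matrix (Fin n) (Fin n) ℝ) : ∃ X, IsMoorePenrose M X := by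
  have hH : (Mᵀ * M).IsHermitian := by
    simp [IsHermitian, conjTranspose_eq_transpose_of_trivial, transpose_mul]
  obtain ⟨H, h, hs⟩ := exists_isMoorePenrose_of_isHermitian hH
  have hA : M * (H * (Mᵀ * M)) = M := by
    have h0 : (M * (H * (Mᵀ * M)) - M)ᵀ * (M * (H * (Mᵀ * M)) - M) = 0 := by
      have e : M * (H * (Mᵀ * M)) - M = M * (H * (Mᵀ * M) - 1) := by
        rw [Matrix.mul_sub, Matrix.mul_one]
      have e2 : Mᵀ * M * (H * (Mᵀ * M) - 1) = 0 := by
        rw [Matrix.mul_sub, Matrix.mul_one, ← Matrix.mul_assoc, h.mul_inv_mul, sub_self]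
      rw [e, transpose_mul, Matrix.mul_assoc, ← Matrix.mul_assoc Mᵀ, e2, Matrix.mul_zero]
    rw [← conjTranspose_eq_transpose_of_trivial, conjTranspose_mul_self_eq_zero] at h0
    exact sub_eq_zero.mp h0
  refine ⟨H * Mᵀ, ⟨?_, ?_, ?_, ?_⟩⟩
  · simpa only [Matrix.mul_assoc] using hA
  · calc H * Mᵀ * M * (H * Mᵀ) = (H * (Mᵀ * M) * H) * Mᵀ := by simp only [Matrix.mul_assoc]
      _ = _ := by rw [h.inv_mul_inv]
  · rw [transpose_mul, transpose_mul, transpose_transpose, hs, Matrix.mul_assoc]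
  · simpa only [Matrix.mul_assoc] using h.symm_right

/-- The Moore–Penrose pseudoinverse of a real square matrix. -/
noncomputable def pinv (M : Matrix (Fin n) (Fin n) ℝ) : Matrix (Fin n) (Fin n) ℝ :=
  Classical.choose (exists_isMoorePenrose M)

theorem pinv_isMoorePenrose (M : Matrix (Fin n) (Fin n) ℝ) : IsMoorePenrose M (pinv M) :=
  Classical.choose_spec (exists_isMoorePenrose M)

/-- The pseudo-determinant: the product of the nonzero eigenvalues, with multiplicity. It is used
here for symmetric matrices only, whose characteristic polynomial splits over `ℝ`. -/
noncomputable def pdet (M : Matrix (Fin n) (Fin n) ℝ) : ℝ :=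
  (M.charpoly.roots.filter (fun x => x ≠ 0)).prod

theorem pdet_eq_prod_eigenvalues {M : Matrix (Fin n) (Fin n) ℝ} (hM : M.IsHermitian) :
    pdet M = ∏ i with hM.eigenvalues i ≠ 0, hM.eigenvalues i := by
  unfold pdet
  rw [hM.roots_charpoly_eq_eigenvalues, Multiset.filter_map, Finset.prod]
  rfl

end PseudoInverse

/-! ### The linear time-invariant system and the sensor's local estimate -/

section Model

variable {n m : ℕ} {Ω : Type*}

/-- The state process `x_{k+1} = A x_k + w_k` started at `x0`. -/
noncomputable def state (A : Matrix (Fin n) (Fin n) ℝ) (x0 : Ω → EuclideanSpace ℝ (Fin n))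
    (w : ℕ → Ω → EuclideanSpace ℝ (Fin n)) : ℕ → Ω → EuclideanSpace ℝ (Fin n)
  | 0 => x0
  | k + 1 => fun ω => toEuclideanLin A (state A x0 w k ω) + w k ω

/-- The measurement `y_k = C x_k + v_k`. -/
noncomputable def measurement (A : Matrix (Fin n) (Fin n) ℝ) (C : Matrix (Fin m) (Fin n) ℝ)
    (x0 : Ω → EuclideanSpace ℝ (Fin n)) (w : ℕ → Ω → EuclideanSpace ℝ (Fin n))
    (v : ℕ → Ω → EuclideanSpace ℝ (Fin m)) (k : ℕ) (ω : Ω) : EuclideanSpace ℝ (Fin m) :=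
  toEuclideanLin C (state A x0 w k ω) + v k ω

/-- The σ-algebra generated by `y_1, …, y_k` (trivial for `k = 0`). -/
abbrev measurementSigma (y : ℕ → Ω → EuclideanSpace ℝ (Fin m)) (k : ℕ) : MeasurableSpace Ω :=
  ⨆ j ∈ Finset.Icc 1 k, MeasurableSpace.comap (y j) inferInstance

/-- The sensor's local MMSE estimate `E[x_k | y_1, …, y_k]`. -/
noncomputable def localEstimate [MeasurableSpace Ω] (P : Measure Ω)
    (x : ℕ → Ω → EuclideanSpace ℝ (Fin n)) (y : ℕ → Ω → EuclideanSpace ℝ (Fin m)) (k : ℕ) :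
    Ω → EuclideanSpace ℝ (Fin n) :=
  P[x k | measurementSigma y k]

/-- The standing probabilistic assumptions on the plant. The initial state is `N(0, P0)`, the state
noises `w_k` are i.i.d. `N(0, Qw)`, the observation noises `v_k` are i.i.d. `N(0, R)`, and the
initial state, the state noise and the observation noise are independent of one another. -/
structure IsGaussianPlant [MeasurableSpace Ω] (P : Measure Ω)
    (P0 Qw : Matrix (Fin n) (Fin n) ℝ) (R : Matrix (Fin m) (Fin m) ℝ)
    (x0 : Ω → EuclideanSpace ℝ (Fin n)) (w : ℕ → Ω → EuclideanSpace ℝ (Fin n))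
    (v : ℕ → Ω → EuclideanSpace ℝ (Fin m)) : Prop where
  posSemidef_init : P0.PosSemidef
  posSemidef_state : Qw.PosSemidef
  posDef_obs : R.PosDef
  measurable_init : Measurable x0
  measurable_state : ∀ k, Measurable (w k)
  measurable_obs : ∀ k, Measurable (v k)
  law_init : HasLaw x0 (multivariateGaussian 0 P0) P
  law_state : ∀ k, HasLaw (w k) (multivariateGaussian 0 Qw) P
  law_obs : ∀ k, HasLaw (v k) (multivariateGaussian 0 R) P
  indep_state : iIndepFun w P
  indep_obs : iIndepFun v P
  indep_state_obs : IndepFun (fun ω k => w k ω) (fun ω k => v k ω) P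
  indep_init : IndepFun x0 (fun ω => ((fun k => w k ω), (fun k => v k ω))) P

/-- The local Kalman filter is in steady state: for every `k`, the error covariance
`E[(x_k - x̂_k)(x_k - x̂_k)' | y_1, …, y_k]` of the local estimate `x̂_k` is the constant matrix
`Pbar`. -/
def IsSteadyState [MeasurableSpace Ω] (P : Measure Ω)
    (x : ℕ → Ω → EuclideanSpace ℝ (Fin n)) (y : ℕ → Ω → EuclideanSpace ℝ (Fin m))
    (Pbar : Matrix (Fin n) (Fin n) ℝ) : Prop :=
  ∀ k : ℕ, ∀ i j : Fin n,
    P[fun ω => (x k ω i - localEstimate P x y k ω i) * (x k ω j - localEstimate P x y k ω j)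
      | measurementSigma y k] =ᵐ[P] fun _ => Pbar i j

/-- The Lyapunov operator `h(X) = A X A' + Qw`. -/
def lyapunov (A Qw X : Matrix (Fin n) (Fin n) ℝ) : Matrix (Fin n) (Fin n) ℝ := A * X * Aᵀ + Qw

/-! ### Remote estimator and power controller -/

/-- The information `I_k = {γ_1 x̂_1, …, γ_k x̂_k} ∪ {γ_1, …, γ_k}` of the remote estimator, as a
σ-algebra. -/
abbrev infoSigma (xs : ℕ → Ω → EuclideanSpace ℝ (Fin n)) (γ : ℕ → Ω → Fin 2) (k : ℕ) :
    MeasurableSpace Ω :=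
  ⨆ j ∈ Finset.Icc 1 k,
    (MeasurableSpace.comap (fun ω => ((γ j ω : ℕ) : ℝ) • xs j ω) inferInstance ⊔
      MeasurableSpace.comap (γ j) inferInstance)

/-- The holding time `τ(k) = k - max {t < k : γ_t = 1}` since the last reception before time `k`.
The set is nonempty for `k ≥ 1`, as `γ_0 = 1`. -/
def holdingTime (γ : ℕ → Ω → Fin 2) (k : ℕ) (ω : Ω) : ℕ :=
  k - ((Finset.range k).filter (fun t => γ t ω = 1)).sup id

/-- The incremental innovation `ε_k = x̂_k - A ^ τ x̂_{k-τ}`, where `τ = τ(k)`. -/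
noncomputable def innovation (A : Matrix (Fin n) (Fin n) ℝ)
    (xs : ℕ → Ω → EuclideanSpace ℝ (Fin n)) (γ : ℕ → Ω → Fin 2) (k : ℕ) (ω : Ω) :
    EuclideanSpace ℝ (Fin n) :=
  xs k ω - toEuclideanLin (A ^ holdingTime γ k ω) (xs (k - holdingTime γ k ω) ω)

/-- The quadratic form `ε' 𝒬 ε`. -/
noncomputable def quadCost (e : EuclideanSpace ℝ (Fin n)) (𝒬 : Matrix (Fin n) (Fin n) ℝ) : ℝ :=
  e.ofLp ⬝ᵥ (𝒬 *ᵥ e.ofLp)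

/-- The transmission power `ω_k = (N₀ W / (2 α)) ε_k' 𝒬_τ ε_k + b` prescribed by the data-driven
controller with weights `𝒬` and baseline `b`. -/
noncomputable def powerEF (A : Matrix (Fin n) (Fin n) ℝ) (𝒬 : ℕ → Matrix (Fin n) (Fin n) ℝ)
    (N₀ W α b : ℝ) (xs : ℕ → Ω → EuclideanSpace ℝ (Fin n)) (γ : ℕ → Ω → Fin 2) (k : ℕ) (ω : Ω) :
    ℝ :=
  N₀ * W / (2 * α) * quadCost (innovation A xs γ k ω) (𝒬 (holdingTime γ k ω)) + b

/-- The σ-algebra generated by the initial state, both noise sequences (at all times) and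
`γ_0, …, γ_{k-1}`. -/
abbrev pastSigma (x0 : Ω → EuclideanSpace ℝ (Fin n)) (w : ℕ → Ω → EuclideanSpace ℝ (Fin n))
    (v : ℕ → Ω → EuclideanSpace ℝ (Fin m)) (γ : ℕ → Ω → Fin 2) (k : ℕ) : MeasurableSpace Ω :=
  MeasurableSpace.comap x0 inferInstance ⊔
    (⨆ j, MeasurableSpace.comap (w j) inferInstance) ⊔
    (⨆ j, MeasurableSpace.comap (v j) inferInstance) ⊔
    ⨆ j ∈ Finset.range k, MeasurableSpace.comap (γ j) inferInstance

/-- The arrival process `γ` (with `γ_0 = 1`) of a memoryless channel whose noise is independent of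
the plant, used with the power process `p`: at time `k ≥ 1`, given the plant noises and the past
arrivals, the packet is dropped with probability `exp(-α / (N₀ W)) ^ p_k`. -/
structure IsChannel [MeasurableSpace Ω] (P : Measure Ω)
    (x0 : Ω → EuclideanSpace ℝ (Fin n)) (w : ℕ → Ω → EuclideanSpace ℝ (Fin n))
    (v : ℕ → Ω → EuclideanSpace ℝ (Fin m)) (N₀ W α : ℝ) (p : ℕ → Ω → ℝ)
    (γ : ℕ → Ω → Fin 2) : Prop where
  measurable : ∀ k, Measurable (γ k)
  initial : ∀ ω, γ 0 ω = 1
  drop : ∀ k, 1 ≤ k →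
    P⟦{ω | γ k ω = 0} | pastSigma x0 w v γ k⟧ =ᵐ[P] fun ω => Real.exp (-α / (N₀ * W)) ^ p k ω

/-! ### The matrices `Ψ_τ` and `Σ_τ` -/

/-- `Ψ_0 = 0` and `Ψ_τ = (𝒬_τ + Σ_τ⁻¹)⁻¹` with `Σ_τ = A Ψ_{τ-1} A' + (h(Pbar) - Pbar)`, where the
inverses are Moore–Penrose pseudoinverses. -/
noncomputable def PsiMat (A Qw Pbar : Matrix (Fin n) (Fin n) ℝ)
    (𝒬 : ℕ → Matrix (Fin n) (Fin n) ℝ) : ℕ → Matrix (Fin n) (Fin n) ℝ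
  | 0 => 0
  | t + 1 =>
    pinv (𝒬 (t + 1) + pinv (A * PsiMat A Qw Pbar 𝒬 t * Aᵀ + (lyapunov A Qw Pbar - Pbar)))

/-- `Σ_τ = A Ψ_{τ-1} A' + (h(Pbar) - Pbar)`, meaningful for `τ ≥ 1`. -/
noncomputable def SigmaMat (A Qw Pbar : Matrix (Fin n) (Fin n) ℝ)
    (𝒬 : ℕ → Matrix (Fin n) (Fin n) ℝ) (t : ℕ) : Matrix (Fin n) (Fin n) ℝ :=
  A * PsiMat A Qw Pbar 𝒬 (t - 1) * Aᵀ + (lyapunov A Qw Pbar - Pbar)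

end Model

end RemoteEstimation

/-! Write `ε_k` for the incremental innovation and `z_k = x̂_{k+1} - A x̂_k` for the one-step
innovation of the local filter. The power is scaled so that `q ^ ω_k = exp(-αb/(N₀W)) · exp(-ε_k'
𝒬_τ ε_k / 2)`, where `b` is the baseline. Everything thus reduces to one fact: on each event of
`I_{k-1}` on which `τ(k) = t`, the vector `ε_k` has law `N(0, Σ_t)`.

The Gaussian computation is `multivariateGaussian_tilt`: the density `exp(-x'𝒬_t x/2)` turns `N(0,
Σ_t)` into `(det Σ_t · det Ψ_t⁻¹)^{-1/2}` times `N(0, Ψ_t)`. The total mass gives the asserted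
probability, and the normalized measure is the law of `ε_k` after a drop. The covariances may be
singular; the assumption `Σ_t ⪰ Ψ_t` forces `ker Σ_t ⊆ ker 𝒬_t`, and this is all that is needed of
it.

The law of `ε_k` is found by induction (`map_innovation_restrict`). After a reception `ε_{k+1} =
z_k`; after a drop `ε_{k+1} = A ε_k + z_k`. By Gaussian regression and the steady state, `z_k` has
law `N(0, h(Pbar) - Pbar)` and is independent of `y_1, …, y_k` (`innovation_law`). It is also
independent of `γ_0, …, γ_k`, because the drop probabilities depend only on past measurements and
arrivals (`indep_stepInnovation_obsSigma`). On a drop the remote estimator learns nothing but the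
drop itself, so `I_k` and `I_{k-1}` have the same trace there. Hence the covariance `Ψ_t` after a
drop becomes `A Ψ_t A' + h(Pbar) - Pbar = Σ_{t+1}`. -/

namespace RemoteEstimation

/-! ### Pseudoinverses and pseudo-determinants of `S` and `Q + S⁺`. -/

section PseudoInverseLemmas

variable {n : ℕ} {M S Q : Matrix (Fin n) (Fin n) ℝ}

theorem IsMoorePenrose.swap {M X : Matrix (Fin n) (Fin n) ℝ} (h : IsMoorePenrose M X) :
    IsMoorePenrose X M :=
  ⟨h.inv_mul_inv, h.mul_inv_mul, h.symm_right, h.symm_left⟩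

theorem IsMoorePenrose.pinv_eq {M X : Matrix (Fin n) (Fin n) ℝ} (h : IsMoorePenrose M X) :
    pinv M = X :=
  (pinv_isMoorePenrose M).unique h

theorem pinv_pinv (M : Matrix (Fin n) (Fin n) ℝ) : pinv (pinv M) = M :=
  (pinv_isMoorePenrose M).swap.pinv_eq

theorem transpose_pinv (hM : M.IsHermitian) : (pinv M)ᵀ = pinv M := by
  obtain ⟨X, hX, hs⟩ := exists_isMoorePenrose_of_isHermitian hM
  rw [hX.pinv_eq, hs]

theorem transpose_eq_of_isHermitian (hM : M.IsHermitian) : Mᵀ = M := by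
  rw [← conjTranspose_eq_transpose_of_trivial]; exact hM

theorem mul_pinv_comm (hM : M.IsHermitian) : M * pinv M = pinv M * M := by
  rw [← (pinv_isMoorePenrose M).symm_left, transpose_mul, transpose_pinv hM,
    transpose_eq_of_isHermitian hM]

/-- `M⁺ = M⁺ M M⁺` with `M⁺` symmetric, so `M⁺` is a congruence transform of `M`. -/
theorem posSemidef_pinv (hM : M.PosSemidef) : (pinv M).PosSemidef := by
  have h := hM.mul_mul_conjTranspose_same (pinv M)
  rwa [conjTranspose_eq_transpose_of_trivial, transpose_pinv hM.isHermitian,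
    (pinv_isMoorePenrose M).inv_mul_inv] at h

/-- The pseudo-determinant is the determinant after adding the projection onto the kernel. -/
theorem pdet_eq_det (hM : M.IsHermitian) : pdet M = (M + (1 - M * pinv M)).det := by
  set U : Matrix (Fin n) (Fin n) ℝ := (hM.eigenvectorUnitary : Matrix (Fin n) (Fin n) ℝ) with hU
  set V : Matrix (Fin n) (Fin n) ℝ := star (hM.eigenvectorUnitary : Matrix (Fin n) (Fin n) ℝ)
  set d := hM.eigenvalues with hd
  have hUV : V * U = 1 := Unitary.coe_star_mul_self hM.eigenvectorUnitary
  have hVU : U * V = 1 := Unitary.coe_mul_star_self hM.eigenvectorUnitary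
  have hV : V = Uᵀ := by
    change star U = Uᵀ
    rw [star_eq_conjTranspose, conjTranspose_eq_transpose_of_trivial]
  have hMd : M = U * diagonal d * V := by
    have h := hM.spectral_theorem
    rw [Unitary.conjStarAlgAut_apply] at h
    exact h
  have key : ∀ a b : Fin n → ℝ, (U * diagonal a * V) * (U * diagonal b * V)
      = U * diagonal (fun i => a i * b i) * V := by
    intro a b
    calc (U * diagonal a * V) * (U * diagonal b * V)
        = U * diagonal a * (V * U) * (diagonal b * V) := by simp only [Matrix.mul_assoc]
      _ = U * (diagonal a * diagonal b) * V := by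
          rw [hUV, Matrix.mul_one]; simp only [Matrix.mul_assoc]
      _ = _ := by rw [diagonal_mul_diagonal]
  have symm : ∀ a : Fin n → ℝ, (U * diagonal a * V)ᵀ = U * diagonal a * V := by
    intro a
    rw [hV]
    simp [transpose_mul, Matrix.mul_assoc]
  have hp : pinv M = U * diagonal (fun i => (d i)⁻¹) * V := by
    refine IsMoorePenrose.pinv_eq ⟨?_, ?_, ?_, ?_⟩
    · rw [hMd, key, key]
      simp only [mul_inv_mul_cancel]
    · rw [hMd, key, key]
      have : ∀ x : ℝ, x⁻¹ * x * x⁻¹ = x⁻¹ := fun x => by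
        by_cases hx : x = 0 <;> simp [hx]
      simp only [this]
    · rw [hMd, key, symm]
    · rw [hMd, key, symm]
  -- Since `0⁻¹ = 0`, the entry `d + (1 - d d⁻¹)` is `d` when `d ≠ 0` and `1` when `d = 0`: zero
  -- eigenvalues are replaced by ones.
  have hsum : M + (1 - M * pinv M)
      = U * diagonal (fun i => d i + (1 - d i * (d i)⁻¹)) * V := by
    have h1 : (1 : Matrix (Fin n) (Fin n) ℝ) = U * diagonal (fun _ => 1) * V := by
      rw [diagonal_one, Matrix.mul_one, hVU]
    rw [hp]
    nth_rw 1 2 [hMd]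
    rw [key, h1, ← Matrix.sub_mul, ← Matrix.mul_sub, ← Matrix.add_mul, ← Matrix.mul_add,
      diagonal_sub, diagonal_add]
  rw [hsum, det_mul, det_mul, mul_right_comm, ← det_mul, hVU, det_one, one_mul, det_diagonal,
    pdet_eq_prod_eigenvalues hM, Finset.prod_filter]
  refine Finset.prod_congr rfl fun i _ => ?_
  by_cases h : hM.eigenvalues i = 0
  · simp [hd, h]
  · simp [hd, h]

/-- If `S - (Q + S⁻¹)⁻¹` is positive semidefinite, then the range of `Q` lies in that of `S`. -/
theorem mul_range_projection (hS : S.PosSemidef) (hQ : Q.PosSemidef)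
    (h : (S - pinv (Q + pinv S)).PosSemidef) : Q * (S * pinv S) = Q := by
  have hN : (Q + pinv S).PosSemidef := hQ.add (posSemidef_pinv hS)
  -- For `x` in the kernel of `S`, the assumption gives `-x'N⁺x ≥ 0` with `N = Q + S⁺`. So `N⁺x =
  -- 0`, hence `Nx = 0`, and the two nonnegative summands of `x'Nx` vanish separately.
  have hker : ∀ x, S *ᵥ x = 0 → Q *ᵥ x = 0 := by
    intro x hx
    have h1 := h.dotProduct_mulVec_nonneg x
    rw [sub_mulVec, hx, zero_sub, dotProduct_neg] at h1
    have h2 := (posSemidef_pinv hN).dotProduct_mulVec_nonneg x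
    have h3 : pinv (Q + pinv S) *ᵥ x = 0 :=
      ((posSemidef_pinv hN).dotProduct_mulVec_zero_iff x).1 (by linarith)
    have h4 : (Q + pinv S) *ᵥ x = 0 := by
      conv_lhs => rw [← (pinv_isMoorePenrose (Q + pinv S)).mul_inv_mul]
      rw [Matrix.mul_assoc, ← mul_pinv_comm hN.isHermitian, ← mulVec_mulVec, ← mulVec_mulVec, h3]
      simp
    have h5 : star x ⬝ᵥ (Q *ᵥ x) + star x ⬝ᵥ (pinv S *ᵥ x) = 0 := by
      rw [← dotProduct_add, ← add_mulVec, h4, dotProduct_zero]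
    have h6 := hQ.dotProduct_mulVec_nonneg x
    have h7 := (posSemidef_pinv hS).dotProduct_mulVec_nonneg x
    exact (hQ.dotProduct_mulVec_zero_iff x).1 (by linarith)
  have h0 : S * (1 - S * pinv S) = 0 := by
    rw [mul_pinv_comm hS.isHermitian, Matrix.mul_sub, Matrix.mul_one, ← Matrix.mul_assoc,
      (pinv_isMoorePenrose S).mul_inv_mul, sub_self]
  have h8 : Q * (1 - S * pinv S) = 0 := by
    ext i j
    have := hker ((1 - S * pinv S) *ᵥ Pi.single j 1) (by rw [mulVec_mulVec, h0, zero_mulVec])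
    rw [mulVec_mulVec, mulVec_single_one] at this
    exact congrFun this i
  rw [Matrix.mul_sub, Matrix.mul_one, sub_eq_zero] at h8
  exact h8.symm

section Factor

variable {L : Matrix (Fin n) (Fin n) ℝ}

/-- With `E = S S⁺`, the Gram matrix of `L(1 - E)` is `(1 - E) S (1 - E) = 0`. -/
theorem mul_range_projection_of_mul_self (hS : S.IsHermitian) (hL : Lᵀ = L) (hLL : L * L = S) :
    L * (S * pinv S) = L := by
  have h0 : (1 - S * pinv S)ᵀ * S * (1 - S * pinv S) = 0 := by
    rw [Matrix.mul_assoc, mul_pinv_comm hS, Matrix.mul_sub S, Matrix.mul_one, ← Matrix.mul_assoc S,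
      (pinv_isMoorePenrose S).mul_inv_mul, sub_self, Matrix.mul_zero]
  have h1 : (L * (1 - S * pinv S))ᵀ * (L * (1 - S * pinv S)) = 0 := by
    rw [transpose_mul, hL, ← h0, ← hLL]
    simp only [Matrix.mul_assoc]
  rw [← conjTranspose_eq_transpose_of_trivial, conjTranspose_mul_self_eq_zero, Matrix.mul_sub,
    Matrix.mul_one, sub_eq_zero] at h1
  exact h1.symm

/-- With `L` the square root of `S`, the matrix `1 + LQL` is positive definite even when `S` and `Q`
are singular, so posterior quantities can be written with a genuine inverse. -/
theorem isUnit_det_one_add (hQ : Q.PosSemidef) (hL : Lᵀ = L) :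
    IsUnit (1 + L * Q * L).det := by
  have h : (L * Q * L).PosSemidef := by
    have := hQ.mul_mul_conjTranspose_same L
    rwa [conjTranspose_eq_transpose_of_trivial, hL] at this
  exact (isUnit_iff_isUnit_det _).1 (PosDef.one.add_posSemidef h).isUnit

/-- The posterior precision times the posterior covariance is the projection onto the range of the
prior covariance. -/
theorem posterior_mul (hS : S.PosSemidef) (hQ : Q.PosSemidef) (hL : Lᵀ = L)
    (hLL : L * L = S) (hr : Q * (S * pinv S) = Q) :
    L * (1 + L * Q * L)⁻¹ * L * (Q + pinv S) = S * pinv S ∧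
      (Q + pinv S) * (L * (1 + L * Q * L)⁻¹ * L) = S * pinv S := by
  have hEt : (S * pinv S)ᵀ = S * pinv S := (pinv_isMoorePenrose S).symm_left
  have hNt : (Q + pinv S)ᵀ = Q + pinv S := by
    rw [transpose_add, transpose_pinv hS.isHermitian, transpose_eq_of_isHermitian hQ.isHermitian]
  have hTt : (L * (1 + L * Q * L)⁻¹ * L)ᵀ = L * (1 + L * Q * L)⁻¹ * L := by
    simp only [transpose_mul, transpose_nonsing_inv, transpose_add, transpose_one, hL,
      transpose_eq_of_isHermitian hQ.isHermitian, Matrix.mul_assoc]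
  have hES : L * (L * pinv S) = S * pinv S := by rw [← Matrix.mul_assoc, hLL]
  have hTN : L * (1 + L * Q * L)⁻¹ * L * (Q + pinv S) = S * pinv S := by
    -- Push-through identity: the range condition `QE = Q` allows `LQ = LQ·L·L S⁺`, so `1 + LQL`
    -- factors out on the left.
    have hX : L * (Q + pinv S) = (1 + L * Q * L) * (L * pinv S) := by
      rw [Matrix.add_mul, Matrix.one_mul, Matrix.mul_assoc (L * Q), hES, Matrix.mul_assoc, hr,
        Matrix.mul_add, add_comm]
    rw [Matrix.mul_assoc, hX, Matrix.mul_assoc,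
      nonsing_inv_mul_cancel_left _ _ (isUnit_det_one_add hQ hL), hES]
  refine ⟨hTN, ?_⟩
  have := congrArg transpose hTN
  rwa [transpose_mul, hTt, hNt, hEt] at this

/-- The posterior covariance of a possibly degenerate Gaussian. -/
theorem isMoorePenrose_posterior (hS : S.PosSemidef) (hQ : Q.PosSemidef) (hL : Lᵀ = L)
    (hLL : L * L = S) (hr : Q * (S * pinv S) = Q) :
    IsMoorePenrose (Q + pinv S) (L * (1 + L * Q * L)⁻¹ * L) := by
  have hEt : (S * pinv S)ᵀ = S * pinv S := (pinv_isMoorePenrose S).symm_left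
  have hEL : S * pinv S * L = L := by
    have := congrArg transpose (mul_range_projection_of_mul_self hS.isHermitian hL hLL)
    rwa [transpose_mul, hL, hEt] at this
  have hNE : (Q + pinv S) * (S * pinv S) = Q + pinv S := by
    rw [Matrix.add_mul, hr, ← Matrix.mul_assoc, (pinv_isMoorePenrose S).inv_mul_inv]
  obtain ⟨hTN, hNT⟩ := posterior_mul hS hQ hL hLL hr
  refine ⟨?_, ?_, ?_, ?_⟩
  · rw [Matrix.mul_assoc, hTN, hNE]
  · rw [hTN, Matrix.mul_assoc L, ← Matrix.mul_assoc, hEL]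
  · rw [hNT, hEt]
  · rw [hTN, hEt]

/-- `S` and `N = Q + S⁺` share the range projection `E = S S⁺`. By `pdet_eq_det` the product is the
determinant of `(S + 1 - E)(N + 1 - E) = SN + 1 - E = 1 + SQ`, and Sylvester's identity moves one
factor `L` of `S = LL` to the other side. -/
theorem pdet_mul_pdet (hS : S.PosSemidef) (hQ : Q.PosSemidef) (hL : Lᵀ = L)
    (hLL : L * L = S) (hr : Q * (S * pinv S) = Q) :
    pdet S * pdet (Q + pinv S) = (1 + L * Q * L).det := by
  have hN : (Q + pinv S).PosSemidef := hQ.add (posSemidef_pinv hS)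
  have hEt : (S * pinv S)ᵀ = S * pinv S := (pinv_isMoorePenrose S).symm_left
  have hE : (Q + pinv S) * pinv (Q + pinv S) = S * pinv S := by
    rw [(isMoorePenrose_posterior hS hQ hL hLL hr).pinv_eq, (posterior_mul hS hQ hL hLL hr).2]
  have h0 : S * (1 - S * pinv S) = 0 := by
    rw [mul_pinv_comm hS.isHermitian, Matrix.mul_sub, Matrix.mul_one, ← Matrix.mul_assoc,
      (pinv_isMoorePenrose S).mul_inv_mul, sub_self]
  have h1 : (1 - S * pinv S) * (Q + pinv S) = 0 := by
    have : (Q + pinv S) * (S * pinv S) = Q + pinv S := by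
      rw [Matrix.add_mul, hr, ← Matrix.mul_assoc, (pinv_isMoorePenrose S).inv_mul_inv]
    have := congrArg transpose this
    rw [transpose_mul, hEt, transpose_eq_of_isHermitian hN.isHermitian] at this
    rw [Matrix.sub_mul, Matrix.one_mul, this, sub_self]
  have h2 : (1 - S * pinv S) * (1 - S * pinv S) = 1 - S * pinv S := by
    rw [Matrix.mul_sub, Matrix.mul_one, ← Matrix.mul_assoc, Matrix.sub_mul 1, Matrix.one_mul,
      (pinv_isMoorePenrose S).mul_inv_mul, sub_self, Matrix.zero_mul, sub_zero]
  rw [pdet_eq_det hS.isHermitian, pdet_eq_det hN.isHermitian, hE, ← det_mul, Matrix.add_mul,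
    Matrix.mul_add, Matrix.mul_add, h0, add_zero,
    Matrix.mul_add (1 - S * pinv S), h1, h2, zero_add,
    show S * Q + S * pinv S + (1 - S * pinv S) = 1 + L * (L * Q) by
      rw [← Matrix.mul_assoc, hLL]; abel, det_one_add_mul_comm]

end Factor

end PseudoInverseLemmas

/-! ### Tilted Gaussian integrals, singular covariances included. -/

section GaussianTilt

variable {n : ℕ}

/-- The tilt raises the precision from `1` to `1 + d`, leaving the Fourier transform of an
unnormalized Gaussian. -/
theorem integral_cexp_gaussianReal (s d : ℝ) (hd : 0 ≤ d) :
    ∫ x : ℝ, Complex.exp (s * x * Complex.I - d * x ^ 2 / 2) ∂gaussianReal 0 1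
      = ((1 / Real.sqrt (1 + d) : ℝ) : ℂ) * Complex.exp (-(s ^ 2 / (1 + d)) / 2) := by
  have hb : 0 < (((1 + d) / 2 : ℝ) : ℂ).re := by
    rw [Complex.ofReal_re]; positivity
  rw [integral_gaussianReal_eq_integral_smul one_ne_zero]
  have h1 : ∀ x : ℝ, gaussianPDFReal 0 1 x • Complex.exp (s * x * Complex.I - d * x ^ 2 / 2)
      = ((1 / Real.sqrt (2 * Real.pi) : ℝ) : ℂ) * (Complex.exp (Complex.I * s * x) *
        Complex.exp (-(((1 + d) / 2 : ℝ) : ℂ) * x ^ 2)) := by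
    intro x
    rw [gaussianPDFReal, Complex.real_smul, Complex.ofReal_mul, Complex.ofReal_exp, mul_assoc,
      ← Complex.exp_add, ← Complex.exp_add]
    congr 1
    · simp
    · congr 1
      push_cast
      ring
  simp_rw [h1]
  rw [integral_const_mul, fourierIntegral_gaussian hb, ← mul_assoc]
  congr 1
  · have h2 : ((Real.pi : ℂ) / (((1 + d) / 2 : ℝ) : ℂ)) ^ (1 / 2 : ℂ)
        = ((Real.sqrt (Real.pi / ((1 + d) / 2)) : ℝ) : ℂ) := by
      rw [Real.sqrt_eq_rpow, Complex.ofReal_cpow (by positivity)]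
      push_cast
      rfl
    rw [h2, ← Complex.ofReal_mul]
    congr 1
    rw [show Real.pi / ((1 + d) / 2) = (2 * Real.pi) / (1 + d) by field_simp,
      Real.sqrt_div (by positivity)]
    have : Real.sqrt (2 * Real.pi) ≠ 0 := by positivity
    field_simp
  · congr 1
    have : (1 + d : ℂ) ≠ 0 := by
      exact_mod_cast (by positivity : (1 + d : ℝ) ≠ 0)
    push_cast
    field_simp
    ring

/-- In an orthonormal eigenbasis of `M` the standard Gaussian is still a product measure and the
quadratic form is a weighted sum of squares, so the integral splits into one-dimensional ones. -/
theorem integral_cexp_stdGaussian {M : Matrix (Fin n) (Fin n) ℝ} (hM : M.PosSemidef)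
    (t : EuclideanSpace ℝ (Fin n)) :
    ∫ x, Complex.exp (inner ℝ x t * Complex.I - quadCost x M / 2)
        ∂stdGaussian (EuclideanSpace ℝ (Fin n))
      = ((1 / Real.sqrt (1 + M).det : ℝ) : ℂ) *
        Complex.exp (-(t.ofLp ⬝ᵥ ((1 + M)⁻¹ *ᵥ t.ofLp) : ℝ) / 2) := by
  have hH := hM.isHermitian
  set b := hH.eigenvectorBasis with hb
  set d := hH.eigenvalues with hd
  have hd0 : ∀ i, 0 ≤ d i := hM.eigenvalues_nonneg
  have hquad : ∀ c : Fin n → ℝ, quadCost (∑ i, c i • b i) M = ∑ i, d i * c i ^ 2 := by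
    intro c
    have h1 : WithLp.toLp 2 (M *ᵥ (∑ i, c i • b i).ofLp) = ∑ i, (c i * d i) • b i := by
      ext j
      simp only [WithLp.ofLp_sum, WithLp.ofLp_smul, mulVec_sum, mulVec_smul, hb,
        hH.mulVec_eigenvectorBasis, smul_smul, hd]
    have h2 : quadCost (∑ i, c i • b i) M
        = inner ℝ (∑ i, (c i * d i) • b i) (∑ i, c i • b i) := by
      rw [← h1, quadCost, EuclideanSpace.inner_eq_star_dotProduct]
      simp
    rw [h2, b.orthonormal.inner_sum]
    refine Finset.sum_congr rfl fun i _ => ?_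
    simp
    ring
  have hdet : (1 + M).det = ∏ i, (1 + d i) := by
    have h := hH.spectral_theorem
    rw [Unitary.conjStarAlgAut_apply] at h
    have hVU : (hH.eigenvectorUnitary : Matrix (Fin n) (Fin n) ℝ) *
        star (hH.eigenvectorUnitary : Matrix (Fin n) (Fin n) ℝ) = 1 :=
      Unitary.coe_mul_star_self hH.eigenvectorUnitary
    have h1 : 1 + M = (hH.eigenvectorUnitary : Matrix (Fin n) (Fin n) ℝ) *
        diagonal (fun i => 1 + d i) * star (hH.eigenvectorUnitary : Matrix (Fin n) (Fin n) ℝ) := by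
      have h2 : diagonal (fun i => 1 + d i) = 1 + diagonal (RCLike.ofReal ∘ hH.eigenvalues) := by
        rw [← diagonal_one, diagonal_add]
        rfl
      rw [h2, Matrix.mul_add, Matrix.add_mul, Matrix.mul_one, hVU]
      exact congrArg _ h
    rw [h1, det_mul, det_mul, mul_right_comm, ← det_mul, hVU, det_one, one_mul, det_diagonal]
  -- Coordinates in the eigenbasis: `(1 + M)⁻¹` divides the `i`-th one by `1 + d i`.
  have hinv : t.ofLp ⬝ᵥ ((1 + M)⁻¹ *ᵥ t.ofLp) = ∑ i, (inner ℝ (b i) t) ^ 2 / (1 + d i) := by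
    have ht : t = ∑ i, (inner ℝ (b i) t : ℝ) • b i := (b.sum_repr' t).symm
    have hu : IsUnit (1 + M).det :=
      (isUnit_iff_isUnit_det _).1 (PosDef.one.add_posSemidef hM).isUnit
    have h1 : (1 + M)⁻¹ *ᵥ t.ofLp = (∑ i, ((inner ℝ (b i) t : ℝ) / (1 + d i)) • b i).ofLp := by
      have h2 : t.ofLp = (1 + M) *ᵥ (∑ i, ((inner ℝ (b i) t : ℝ) / (1 + d i)) • b i).ofLp := by
        conv_lhs => rw [ht]
        simp only [WithLp.ofLp_sum, WithLp.ofLp_smul, mulVec_sum, mulVec_smul, add_mulVec,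
          one_mulVec, hb, hH.mulVec_eigenvectorBasis]
        refine Finset.sum_congr rfl fun i _ => ?_
        have : 1 + d i ≠ 0 := by linarith [hd0 i]
        rw [← one_smul ℝ (hH.eigenvectorBasis i).ofLp, smul_smul, smul_smul, ← add_smul, smul_smul]
        congr 1
        field_simp
        rfl
      rw [h2, mulVec_mulVec, nonsing_inv_mul _ hu, one_mulVec]
    have h3 : t.ofLp ⬝ᵥ (∑ i, ((inner ℝ (b i) t : ℝ) / (1 + d i)) • b i).ofLp
        = inner ℝ (∑ i, ((inner ℝ (b i) t : ℝ) / (1 + d i)) • b i) t := by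
      rw [EuclideanSpace.inner_eq_star_dotProduct]
      simp
    rw [h1, h3, sum_inner]
    refine Finset.sum_congr rfl fun i _ => ?_
    rw [inner_smul_left]
    simp
    ring
  rw [stdGaussian_eq_map_pi_orthonormalBasis b, integral_map
    (Measurable.aemeasurable (by fun_prop)) (Continuous.aestronglyMeasurable (by
      unfold quadCost; fun_prop))]
  have h3 : ∀ x : Fin n → ℝ, Complex.exp (inner ℝ (∑ i, x i • b i) t * Complex.I
        - quadCost (∑ i, x i • b i) M / 2)
      = ∏ i, Complex.exp ((inner ℝ (b i) t : ℝ) * (x i : ℝ) * Complex.I - d i * x i ^ 2 / 2) := by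
    intro x
    rw [hquad, ← Complex.exp_sum, sum_inner, Finset.sum_sub_distrib]
    congr 2
    · push_cast
      rw [Finset.sum_mul]
      refine Finset.sum_congr rfl fun i _ => ?_
      rw [inner_smul_left]
      simp
      ring
    · push_cast
      rw [Finset.sum_div]
  simp_rw [h3]
  rw [integral_fintype_prod_eq_prod (𝕜 := ℂ) (fun i (x : ℝ) =>
    Complex.exp ((inner ℝ (b i) t : ℝ) * x * Complex.I - d i * x ^ 2 / 2))]
  simp_rw [fun i => integral_cexp_gaussianReal (inner ℝ (b i) t) (d i) (hd0 i)]
  rw [Finset.prod_mul_distrib, ← Complex.exp_sum, hdet, hinv, ← Complex.ofReal_prod]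
  congr 2
  · rw [Finset.prod_div_distrib, Finset.prod_const_one, Real.sqrt_prod _ fun i _ => by
      linarith [hd0 i]]
  · push_cast
    rw [← Finset.sum_neg_distrib, Finset.sum_div]

open scoped MatrixOrder in
theorem cfc_sqrt_facts {S : Matrix (Fin n) (Fin n) ℝ} (hS : S.PosSemidef) :
    (CFC.sqrt S)ᵀ = CFC.sqrt S ∧ CFC.sqrt S * CFC.sqrt S = S :=
  ⟨transpose_eq_of_isHermitian (CFC.sqrt_nonneg S).posSemidef.isHermitian,
    CFC.sqrt_mul_sqrt_self S hS.nonneg⟩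

theorem quadCost_nonneg {Q : Matrix (Fin n) (Fin n) ℝ} (hQ : Q.PosSemidef)
    (x : EuclideanSpace ℝ (Fin n)) : 0 ≤ quadCost x Q := by
  unfold quadCost
  simpa using hQ.dotProduct_mulVec_nonneg x.ofLp

@[fun_prop]
theorem continuous_quadCost (Q : Matrix (Fin n) (Fin n) ℝ) :
    Continuous fun x : EuclideanSpace ℝ (Fin n) => quadCost x Q := by
  unfold quadCost
  fun_prop

open scoped MatrixOrder in
/-- Tilting a centered Gaussian by `exp (-x'Qx/2)` gives a multiple of a centered Gaussian. -/
theorem multivariateGaussian_tilt {S Q : Matrix (Fin n) (Fin n) ℝ} (hS : S.PosSemidef)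
    (hQ : Q.PosSemidef) (hSQ : (S - pinv (Q + pinv S)).PosSemidef) :
    (multivariateGaussian 0 S).withDensity
        (fun x => ENNReal.ofReal (Real.exp (-quadCost x Q / 2)))
      = ENNReal.ofReal (1 / Real.sqrt (pdet S * pdet (pinv (pinv (Q + pinv S))))) •
        multivariateGaussian 0 (pinv (Q + pinv S)) := by
  obtain ⟨hL, hLL⟩ := cfc_sqrt_facts hS
  set L := CFC.sqrt S with hLdef
  have hr := mul_range_projection hS hQ hSQ
  have hmeas : Measurable fun x : EuclideanSpace ℝ (Fin n) =>
      ENNReal.ofReal (Real.exp (-quadCost x Q / 2)) := by fun_prop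
  have hpos : 0 ≤ 1 / Real.sqrt (pdet S * pdet (pinv (pinv (Q + pinv S)))) := by positivity
  have hM : (L * Q * L).PosSemidef := by
    have := hQ.mul_mul_conjTranspose_same L
    rwa [conjTranspose_eq_transpose_of_trivial, hL] at this
  have hfin : IsFiniteMeasure ((multivariateGaussian 0 S).withDensity
      (fun x => ENNReal.ofReal (Real.exp (-quadCost x Q / 2)))) := by
    refine isFiniteMeasure_withDensity_ofReal ?_
    refine (hasFiniteIntegral_const (1 : ℝ)).mono' (ae_of_all _ fun x => ?_)
    rw [Real.norm_eq_abs, Real.abs_exp]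
    have := quadCost_nonneg hQ x
    exact Real.exp_le_one_iff.2 (by linarith)
  have hfin' : IsFiniteMeasure (ENNReal.ofReal (1 / Real.sqrt (pdet S *
      pdet (pinv (pinv (Q + pinv S))))) • multivariateGaussian 0 (pinv (Q + pinv S))) :=
    Measure.smul_finite _ ENNReal.ofReal_ne_top
  -- A singular `N(0, S)` has no Lebesgue density, so the two finite measures are compared through
  -- their characteristic functions.
  refine Measure.ext_of_charFun (funext fun t => ?_)
  rw [charFun_apply, charFun_apply, integral_smul_measure,
    ← charFun_apply (μ := multivariateGaussian 0 (pinv (Q + pinv S))),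
    charFun_multivariateGaussian (posSemidef_pinv (hQ.add (posSemidef_pinv hS))),
    integral_withDensity_eq_integral_toReal_smul hmeas (by simp), ENNReal.toReal_ofReal hpos,
    multivariateGaussian, integral_map (by fun_prop)
      (Measurable.aestronglyMeasurable (by fun_prop)), pinv_pinv,
    pdet_mul_pdet hS hQ hL hLL hr, (isMoorePenrose_posterior hS hQ hL hLL hr).pinv_eq]
  -- `N(0, S)` is the image of the standard Gaussian under `L = √S`; pulling back turns `Q` into
  -- `LQL` and the frequency `t` into `Lt`.
  have key := integral_cexp_stdGaussian hM (WithLp.toLp 2 (L *ᵥ t.ofLp))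
  have h1 : ∀ x : EuclideanSpace ℝ (Fin n),
      (ENNReal.ofReal (Real.exp (-quadCost (0 + toEuclideanCLM (𝕜 := ℝ) L x) Q / 2))).toReal •
        Complex.exp (inner ℝ (0 + toEuclideanCLM (𝕜 := ℝ) L x) t * Complex.I)
      = Complex.exp (inner ℝ x (WithLp.toLp 2 (L *ᵥ t.ofLp)) * Complex.I
        - quadCost x (L * Q * L) / 2) := by
    intro x
    have h2 : quadCost (0 + toEuclideanCLM (𝕜 := ℝ) L x) Q = quadCost x (L * Q * L) := by
      rw [zero_add, quadCost, quadCost, ofLp_toEuclideanCLM, ← mulVec_mulVec, ← mulVec_mulVec,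
        dotProduct_mulVec x.ofLp, ← mulVec_transpose, hL]
    have h3 : inner ℝ (0 + toEuclideanCLM (𝕜 := ℝ) L x) t
        = inner ℝ x (WithLp.toLp 2 (L *ᵥ t.ofLp)) := by
      rw [zero_add, EuclideanSpace.inner_eq_star_dotProduct,
        EuclideanSpace.inner_eq_star_dotProduct, ofLp_toEuclideanCLM]
      simp only [star_trivial]
      rw [dotProduct_mulVec, ← mulVec_transpose, hL]
    rw [ENNReal.toReal_ofReal (Real.exp_nonneg _), h2, h3, Complex.real_smul, Complex.ofReal_exp,
      ← Complex.exp_add]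
    congr 1
    push_cast
    ring
  rw [← hLdef]
  simp_rw [h1]
  rw [key, Complex.real_smul]
  congr 2
  have h4 : (L *ᵥ t.ofLp) ⬝ᵥ ((1 + L * Q * L)⁻¹ *ᵥ (L *ᵥ t.ofLp))
      = t.ofLp ⬝ᵥ ((L * (1 + L * Q * L)⁻¹ * L) *ᵥ t.ofLp) := by
    rw [← mulVec_mulVec, ← mulVec_mulVec, dotProduct_mulVec t.ofLp, ← mulVec_transpose, hL]
  rw [h4]
  simp [neg_div]

end GaussianTilt

end RemoteEstimation

namespace RemoteEstimation

/-! ### Linear regression for centered Gaussian vectors. -/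

section Regression

variable {Ω : Type*} [MeasurableSpace Ω] {P : Measure Ω}
  {H : Type*} [NormedAddCommGroup H] [NormedSpace ℝ H] [MeasurableSpace H] [BorelSpace H]
  [CompleteSpace H] [SecondCountableTopology H] {G : Ω → H}
  {F : Type*} [NormedAddCommGroup F] [NormedSpace ℝ F] [MeasurableSpace F] [BorelSpace F]
  [CompleteSpace F] [SecondCountableTopology F]
  {E : Type*} [NormedAddCommGroup E] [NormedSpace ℝ E] [MeasurableSpace E] [BorelSpace E]
  [CompleteSpace E] [SecondCountableTopology E]

/-- The second moment of two linear functionals of a random vector. -/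
noncomputable abbrev secondMoment (P : Measure Ω) (G : Ω → H) :
    StrongDual ℝ H →L[ℝ] StrongDual ℝ H →L[ℝ] ℝ :=
  uncenteredCovarianceBilinDual (P.map G)

/-- Two linear functions of a centered random vector are uncorrelated. -/
abbrev Uncorrelated (P : Measure Ω) (G : Ω → H) (X : H →L[ℝ] E) (M : H →L[ℝ] F) : Prop :=
  ∀ (l : StrongDual ℝ E) (l' : StrongDual ℝ F), secondMoment P G (l.comp X) (l'.comp M) = 0

theorem secondMoment_apply (hG : HasGaussianLaw G P) (L L' : StrongDual ℝ H) :
    secondMoment P G L L' = ∫ ω, L (G ω) * L' (G ω) ∂P := by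
  have := hG.isGaussian_map
  rw [uncenteredCovarianceBilinDual_apply IsGaussian.memLp_two_id,
    integral_map hG.aemeasurable (Continuous.aestronglyMeasurable (by fun_prop))]

theorem secondMoment_comm (hG : HasGaussianLaw G P) (L L' : StrongDual ℝ H) :
    secondMoment P G L L' = secondMoment P G L' L := by
  simp_rw [secondMoment_apply hG, mul_comm]

theorem covariance_eq_secondMoment (hG : HasGaussianLaw G P)
    (h0 : ∀ L : StrongDual ℝ H, ∫ ω, L (G ω) ∂P = 0) (L L' : StrongDual ℝ H) :
    cov[fun ω => L (G ω), fun ω => L' (G ω); P] = secondMoment P G L L' := by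
  rw [secondMoment_apply hG, covariance, h0, h0]
  simp

theorem indepFun_of_secondMoment_eq_zero (hG : HasGaussianLaw G P)
    (h0 : ∀ L : StrongDual ℝ H, ∫ ω, L (G ω) ∂P = 0) (X : H →L[ℝ] E) (M : H →L[ℝ] F)
    (h : Uncorrelated P G X M) :
    IndepFun (fun ω => X (G ω)) (fun ω => M (G ω)) P := by
  refine HasGaussianLaw.indepFun_of_covariance_strongDual (hG.map_fun (X.prod M)) fun l l' => ?_
  rw [← h l l', ← covariance_eq_secondMoment hG h0]
  rfl

/-- The residual `X - KM` is centered and uncorrelated with `M`. Joint Gaussianity makes it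
independent of `M`, so its conditional expectation vanishes and only `KM` survives. -/
theorem condExp_of_regression (hG : HasGaussianLaw G P) (hGm : Measurable G)
    (h0 : ∀ L : StrongDual ℝ H, ∫ ω, L (G ω) ∂P = 0) (X : H →L[ℝ] E) (M : H →L[ℝ] F)
    (K : F →L[ℝ] E)
    (h : Uncorrelated P G (X - K.comp M) M) :
    P[fun ω => X (G ω) | MeasurableSpace.comap (fun ω => M (G ω)) inferInstance]
      =ᵐ[P] fun ω => K (M (G ω)) := by
  have := hG.isProbabilityMeasure
  have hM : Measurable fun ω => M (G ω) := by fun_prop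
  have hR : Measurable fun ω => (X - K.comp M) (G ω) := by fun_prop
  have hind := indepFun_of_secondMoment_eq_zero hG h0 _ _ h
  have hint : ∫ ω, (X - K.comp M) (G ω) ∂P = 0 := by
    rw [SeparatingDual.eq_iff_forall_dual_eq (R := ℝ)]
    intro l
    rw [← ContinuousLinearMap.integral_comp_comm _ (hG.map_fun _).integrable, map_zero]
    exact h0 (l.comp (X - K.comp M))
  have h1 : P[fun ω => (X - K.comp M) (G ω) |
      MeasurableSpace.comap (fun ω => M (G ω)) inferInstance] =ᵐ[P] fun _ => 0 := by
    have := condExp_indep_eq (f := fun ω => (X - K.comp M) (G ω)) hR.comap_le hM.comap_le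
      (comap_measurable _).stronglyMeasurable hind
    rwa [hint] at this
  have h2 : P[fun ω => K (M (G ω)) |
      MeasurableSpace.comap (fun ω => M (G ω)) inferInstance] = fun ω => K (M (G ω)) :=
    condExp_of_stronglyMeasurable hM.comap_le
      (K.measurable.comp (comap_measurable _)).stronglyMeasurable
      (hG.map_fun (K.comp M)).integrable
  have h3 := condExp_add (hG.map_fun (X - K.comp M)).integrable
    (hG.map_fun (K.comp M)).integrable
    (MeasurableSpace.comap (fun ω => M (G ω)) inferInstance)
  have h4 : ((fun ω => (X - K.comp M) (G ω)) + fun ω => (K.comp M) (G ω))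
      = fun ω => X (G ω) := by
    ext ω
    simp
  rw [h4] at h3
  filter_upwards [h1, h3] with ω h1 h3
  rw [h3, Pi.add_apply, h1, zero_add]
  exact congrFun h2 ω

end Regression

section EuclideanRegression

variable {Ω : Type*} [MeasurableSpace Ω] {P : Measure Ω}
  {H : Type*} [NormedAddCommGroup H] [NormedSpace ℝ H] [MeasurableSpace H] [BorelSpace H]
  {G : Ω → H}
  {F : Type*} [NormedAddCommGroup F] [NormedSpace ℝ F] {n : ℕ}

/-- The regression coefficient is an orthogonal projection in `L²` onto the finite-dimensional space
of functionals `l ∘ M`; no covariance has to be inverted, so `M` may be degenerate. -/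
theorem exists_regression [FiniteDimensional ℝ F] (M : H →L[ℝ] F) (L : StrongDual ℝ H) :
    ∃ K : StrongDual ℝ F, ∀ l : StrongDual ℝ F,
      secondMoment P G (L - K.comp M) (l.comp M) = 0 := by
  let T : StrongDual ℝ F →ₗ[ℝ] Lp ℝ 2 (P.map G) :=
    { toFun l := StrongDual.toLp (P.map G) 2 (l.comp M)
      map_add' a b := by rw [ContinuousLinearMap.add_comp, map_add]
      map_smul' c a := by rw [ContinuousLinearMap.smul_comp, map_smul]; rfl }
  have hfd : FiniteDimensional ℝ (LinearMap.range T) := inferInstance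
  obtain ⟨K, hK⟩ : (LinearMap.range T).starProjection (StrongDual.toLp (P.map G) 2 L)
      ∈ LinearMap.range T := Submodule.starProjection_apply_mem _ _
  refine ⟨K, fun l => ?_⟩
  have h := Submodule.starProjection_inner_eq_zero (K := LinearMap.range T)
    (StrongDual.toLp (P.map G) 2 L) (T l) ⟨l, rfl⟩
  rw [← hK] at h
  change inner ℝ (StrongDual.toLp (P.map G) 2 (L - K.comp M)) (T l) = 0
  rw [map_sub]
  exact h

theorem strongDual_eq_sum_proj (l : StrongDual ℝ (EuclideanSpace ℝ (Fin n))) :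
    l = ∑ i, l (EuclideanSpace.single i 1) • (EuclideanSpace.proj i :
      StrongDual ℝ (EuclideanSpace ℝ (Fin n))) := by
  ext x
  conv_lhs => rw [← (EuclideanSpace.basisFun (Fin n) ℝ).sum_repr x]
  simp [mul_comm]

theorem secondMoment_comp_left (l : StrongDual ℝ (EuclideanSpace ℝ (Fin n)))
    (Z : H →L[ℝ] EuclideanSpace ℝ (Fin n)) (L : StrongDual ℝ H) :
    secondMoment P G (l.comp Z) L = ∑ i, l (EuclideanSpace.single i 1) *
      secondMoment P G ((EuclideanSpace.proj i :
        StrongDual ℝ (EuclideanSpace ℝ (Fin n))).comp Z) L := by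
  conv_lhs => rw [strongDual_eq_sum_proj l]
  simp only [ContinuousLinearMap.finsetSum_comp, ContinuousLinearMap.smul_comp, map_sum,
    map_smul, _root_.sum_apply, _root_.smul_apply, smul_eq_mul]

theorem Uncorrelated.pi {κ E : Type*} [Fintype κ] [DecidableEq κ] [NormedAddCommGroup E]
    [NormedSpace ℝ E] {X : H →L[ℝ] E} {f : κ → H →L[ℝ] F}
    (h : ∀ j, Uncorrelated P G X (f j)) :
    Uncorrelated P G X (ContinuousLinearMap.pi f) := by
  intro l l'
  have h1 : l'.comp (ContinuousLinearMap.pi f)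
      = ∑ j, (l'.comp (ContinuousLinearMap.single ℝ (fun _ => F) j)).comp (f j) := by
    ext x
    rw [ContinuousLinearMap.comp_apply, ← l'.sum_comp_single, _root_.sum_apply]
    rfl
  rw [h1, map_sum]
  exact Finset.sum_eq_zero fun j _ => h j l _

theorem exists_euclidean_regression [FiniteDimensional ℝ F] (M : H →L[ℝ] F)
    (X : H →L[ℝ] EuclideanSpace ℝ (Fin n)) :
    ∃ K : F →L[ℝ] EuclideanSpace ℝ (Fin n), Uncorrelated P G (X - K.comp M) M := by
  choose K hK using fun i => exists_regression (P := P) (G := G) M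
    ((EuclideanSpace.proj i : StrongDual ℝ (EuclideanSpace ℝ (Fin n))).comp X)
  refine ⟨∑ i, (K i).smulRight (EuclideanSpace.single i 1), fun l l' => ?_⟩
  rw [secondMoment_comp_left]
  refine Finset.sum_eq_zero fun i _ => ?_
  have h : (EuclideanSpace.proj i : StrongDual ℝ (EuclideanSpace ℝ (Fin n))).comp
      (X - (∑ j, (K j).smulRight (EuclideanSpace.single j 1)).comp M)
      = (EuclideanSpace.proj i : StrongDual ℝ (EuclideanSpace ℝ (Fin n))).comp X
        - (K i).comp M := by
    ext x
    simp
  rw [h, hK, mul_zero]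

end EuclideanRegression

end RemoteEstimation

namespace RemoteEstimation

/-! ### Second moments of the filter innovation. -/

section LinearModel

variable {Ω : Type*} [MeasurableSpace Ω] {P : Measure Ω} {n m : ℕ}
  {H : Type*} [NormedAddCommGroup H] [NormedSpace ℝ H]

/-- The state as a linear function of the initial state and the noises. -/
noncomputable def stateMap (A : Matrix (Fin n) (Fin n) ℝ) (X0 : H →L[ℝ] EuclideanSpace ℝ (Fin n))
    (W : ℕ → H →L[ℝ] EuclideanSpace ℝ (Fin n)) : ℕ → H →L[ℝ] EuclideanSpace ℝ (Fin n)
  | 0 => X0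
  | k + 1 => (toEuclideanLin A).toContinuousLinearMap.comp (stateMap A X0 W k) + W k

/-- The measurements `y_1, …, y_k` as a linear function of the initial state and the noises. -/
noncomputable def historyMap (A : Matrix (Fin n) (Fin n) ℝ) (C : Matrix (Fin m) (Fin n) ℝ)
    (X0 : H →L[ℝ] EuclideanSpace ℝ (Fin n)) (W : ℕ → H →L[ℝ] EuclideanSpace ℝ (Fin n))
    (V : ℕ → H →L[ℝ] EuclideanSpace ℝ (Fin m)) (k : ℕ) :
    H →L[ℝ] (Finset.Icc 1 k → EuclideanSpace ℝ (Fin m)) :=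
  ContinuousLinearMap.pi fun j =>
    (toEuclideanLin C).toContinuousLinearMap.comp (stateMap A X0 W j) + V j

variable {A : Matrix (Fin n) (Fin n) ℝ} {C : Matrix (Fin m) (Fin n) ℝ}
  {X0 : H →L[ℝ] EuclideanSpace ℝ (Fin n)} {W : ℕ → H →L[ℝ] EuclideanSpace ℝ (Fin n)}
  {V : ℕ → H →L[ℝ] EuclideanSpace ℝ (Fin m)} {N : ℕ}

/-- The estimation error of a linear estimator based on the measurements. -/
noncomputable abbrev errorMap (A : Matrix (Fin n) (Fin n) ℝ) (C : Matrix (Fin m) (Fin n) ℝ)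
    (X0 : H →L[ℝ] EuclideanSpace ℝ (Fin n)) (W : ℕ → H →L[ℝ] EuclideanSpace ℝ (Fin n))
    (V : ℕ → H →L[ℝ] EuclideanSpace ℝ (Fin m)) (k : ℕ)
    (K : (Finset.Icc 1 k → EuclideanSpace ℝ (Fin m)) →L[ℝ] EuclideanSpace ℝ (Fin n)) :
    H →L[ℝ] EuclideanSpace ℝ (Fin n) :=
  stateMap A X0 W k - K.comp (historyMap A C X0 W V k)

/-- The difference between consecutive linear estimates. -/
noncomputable abbrev innovationMap (A : Matrix (Fin n) (Fin n) ℝ) (C : Matrix (Fin m) (Fin n) ℝ)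
    (X0 : H →L[ℝ] EuclideanSpace ℝ (Fin n)) (W : ℕ → H →L[ℝ] EuclideanSpace ℝ (Fin n))
    (V : ℕ → H →L[ℝ] EuclideanSpace ℝ (Fin m)) (N : ℕ)
    (K : (Finset.Icc 1 N → EuclideanSpace ℝ (Fin m)) →L[ℝ] EuclideanSpace ℝ (Fin n))
    (K' : (Finset.Icc 1 (N + 1) → EuclideanSpace ℝ (Fin m)) →L[ℝ] EuclideanSpace ℝ (Fin n)) :
    H →L[ℝ] EuclideanSpace ℝ (Fin n) :=
  K'.comp (historyMap A C X0 W V (N + 1)) -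
    (toEuclideanLin A).toContinuousLinearMap.comp (K.comp (historyMap A C X0 W V N))

variable {K : (Finset.Icc 1 N → EuclideanSpace ℝ (Fin m)) →L[ℝ] EuclideanSpace ℝ (Fin n)}
  {K' : (Finset.Icc 1 (N + 1) → EuclideanSpace ℝ (Fin m)) →L[ℝ] EuclideanSpace ℝ (Fin n)}

/-- Both sides equal `x_{N+1} - A x̂_N`: on the left the estimate `x̂_{N+1}` cancels, on the right
the plant equation is used. -/
theorem errorMap_add_innovationMap :
    errorMap A C X0 W V (N + 1) K' + innovationMap A C X0 W V N K K'
      = (toEuclideanLin A).toContinuousLinearMap.comp (errorMap A C X0 W V N K) + W N := by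
  rw [errorMap, errorMap, innovationMap, stateMap, ContinuousLinearMap.comp_sub]
  abel

theorem exists_restrict_history
    (l : StrongDual ℝ (Finset.Icc 1 N → EuclideanSpace ℝ (Fin m))) :
    ∃ l' : StrongDual ℝ (Finset.Icc 1 (N + 1) → EuclideanSpace ℝ (Fin m)),
      l.comp (historyMap A C X0 W V N) = l'.comp (historyMap A C X0 W V (N + 1)) :=
  ⟨l.comp (ContinuousLinearMap.pi fun j => ContinuousLinearMap.proj
    (⟨j, Finset.Icc_subset_Icc_right (Nat.le_succ N) j.2⟩ : Finset.Icc 1 (N + 1))), rfl⟩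

variable [MeasurableSpace H] [BorelSpace H] {G : Ω → H}

/-- For `k ≤ N` the state `x_k` involves only `x_0` and noises `w_j` with `j < N`. -/
theorem secondMoment_noise_state
    (hX0 : Uncorrelated P G (W N) X0)
    (hW : ∀ j < N, Uncorrelated P G (W N) (W j)) (k : ℕ)
    (hk : k ≤ N) : Uncorrelated P G (W N) (stateMap A X0 W k) := by
  intro l l'
  induction k generalizing l' with
  | zero => exact hX0 l l'
  | succ k ih =>
    rw [stateMap, ContinuousLinearMap.comp_add, map_add, hW k hk, add_zero]
    exact ih (by omega) (l'.comp (toEuclideanLin A).toContinuousLinearMap)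

theorem secondMoment_noise_history
    (hX0 : Uncorrelated P G (W N) X0)
    (hW : ∀ j < N, Uncorrelated P G (W N) (W j))
    (hV : ∀ j ≤ N, Uncorrelated P G (W N) (V j)) :
    Uncorrelated P G (W N) (historyMap A C X0 W V N) := by
  refine Uncorrelated.pi fun j l l' => ?_
  have hj := (Finset.mem_Icc.1 j.2).2
  rw [ContinuousLinearMap.comp_add, map_add, hV j hj, add_zero]
  exact secondMoment_noise_state hX0 hW j hj l (l'.comp (toEuclideanLin C).toContinuousLinearMap)

/-- In the identity `R' + Z = A R + w_N`, the terms `R'`, `R` and `w_N` are all orthogonal to the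
first `N` measurements, hence so is `Z`. -/
theorem secondMoment_innovation_history
    (hWY : Uncorrelated P G (W N) (historyMap A C X0 W V N))
    (hK : Uncorrelated P G (errorMap A C X0 W V N K)
      (historyMap A C X0 W V N))
    (hK' : Uncorrelated P G (errorMap A C X0 W V (N + 1) K')
      (historyMap A C X0 W V (N + 1)))
    (l : StrongDual ℝ (EuclideanSpace ℝ (Fin n)))
    (l' : StrongDual ℝ (Finset.Icc 1 N → EuclideanSpace ℝ (Fin m))) :
    secondMoment P G (l.comp (innovationMap A C X0 W V N K K'))
      (l'.comp (historyMap A C X0 W V N)) = 0 := by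
  have h := congrArg (fun T => secondMoment P G (l.comp T) (l'.comp (historyMap A C X0 W V N)))
    (errorMap_add_innovationMap (A := A) (C := C) (X0 := X0) (W := W) (V := V) (K := K) (K' := K'))
  simp only [ContinuousLinearMap.comp_add, map_add, _root_.add_apply] at h
  rw [hWY, ← ContinuousLinearMap.comp_assoc, hK] at h
  obtain ⟨l'', hl''⟩ := exists_restrict_history (A := A) (C := C) (X0 := X0) (W := W) (V := V) l'
  rw [hl'', hK', ← hl''] at h
  simpa using h

/-- Take covariances in `R' + Z = A R + w_N`. Both cross terms vanish, leaving `Pbar + Cov Z = A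
Pbar A' + Qw`; the steady state supplies the same `Pbar` at times `N` and `N + 1`. -/
theorem secondMoment_innovation [CompleteSpace H] [SecondCountableTopology H]
    {Qw Pbar : Matrix (Fin n) (Fin n) ℝ} (hG : HasGaussianLaw G P)
    (hWX : Uncorrelated P G (W N) (stateMap A X0 W N))
    (hWY : Uncorrelated P G (W N) (historyMap A C X0 W V N))
    (hQ : ∀ a b, secondMoment P G
      ((EuclideanSpace.proj a : StrongDual ℝ (EuclideanSpace ℝ (Fin n))).comp (W N))
      ((EuclideanSpace.proj b : StrongDual ℝ (EuclideanSpace ℝ (Fin n))).comp (W N)) = Qw a b)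
    (hK' : Uncorrelated P G (errorMap A C X0 W V (N + 1) K')
      (historyMap A C X0 W V (N + 1)))
    (hR : ∀ a b, secondMoment P G
      ((EuclideanSpace.proj a : StrongDual ℝ (EuclideanSpace ℝ (Fin n))).comp
        (errorMap A C X0 W V N K))
      ((EuclideanSpace.proj b : StrongDual ℝ (EuclideanSpace ℝ (Fin n))).comp
        (errorMap A C X0 W V N K)) = Pbar a b)
    (hR' : ∀ a b, secondMoment P G
      ((EuclideanSpace.proj a : StrongDual ℝ (EuclideanSpace ℝ (Fin n))).comp
        (errorMap A C X0 W V (N + 1) K'))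
      ((EuclideanSpace.proj b : StrongDual ℝ (EuclideanSpace ℝ (Fin n))).comp
        (errorMap A C X0 W V (N + 1) K')) = Pbar a b) (a b : Fin n) :
    secondMoment P G
      ((EuclideanSpace.proj a : StrongDual ℝ (EuclideanSpace ℝ (Fin n))).comp
        (innovationMap A C X0 W V N K K'))
      ((EuclideanSpace.proj b : StrongDual ℝ (EuclideanSpace ℝ (Fin n))).comp
        (innovationMap A C X0 W V N K K')) = (lyapunov A Qw Pbar - Pbar) a b := by
  set R := errorMap A C X0 W V N K with hRdef
  set R' := errorMap A C X0 W V (N + 1) K' with hR'def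
  set Z := innovationMap A C X0 W V N K K' with hZdef
  have hsum : R' + Z = (toEuclideanLin A).toContinuousLinearMap.comp R + W N :=
    errorMap_add_innovationMap
  have hWR : Uncorrelated P G (W N) R := by
    intro l l'
    rw [hRdef, ContinuousLinearMap.comp_sub, map_sub, hWX, ← ContinuousLinearMap.comp_assoc, hWY,
      sub_zero]
  -- `Z` is a linear function of the measurements up to time `N + 1`, to which the error `R'` is
  -- orthogonal.
  have hRZ : Uncorrelated P G R' Z := by
    intro l l'
    obtain ⟨l'', hl''⟩ := exists_restrict_history (A := A) (C := C) (X0 := X0) (W := W) (V := V)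
      (l'.comp ((toEuclideanLin A).toContinuousLinearMap.comp K))
    have : l'.comp Z = (l'.comp K').comp (historyMap A C X0 W V (N + 1))
        - l''.comp (historyMap A C X0 W V (N + 1)) := by
      rw [← hl'', hZdef, ContinuousLinearMap.comp_sub]
      rfl
    rw [this, map_sub, hK', hK', sub_zero]
  have hproj : ∀ c : Fin n, (EuclideanSpace.proj c :
      StrongDual ℝ (EuclideanSpace ℝ (Fin n))).comp (toEuclideanLin A).toContinuousLinearMap
      = ∑ i, A c i • (EuclideanSpace.proj i : StrongDual ℝ (EuclideanSpace ℝ (Fin n))) := by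
    intro c
    ext x
    simp [toLpLin_apply, mulVec, dotProduct]
  have hAR : secondMoment P G
      (((EuclideanSpace.proj a : StrongDual ℝ (EuclideanSpace ℝ (Fin n))).comp
        (toEuclideanLin A).toContinuousLinearMap).comp R)
      (((EuclideanSpace.proj b : StrongDual ℝ (EuclideanSpace ℝ (Fin n))).comp
        (toEuclideanLin A).toContinuousLinearMap).comp R) = (A * Pbar * Aᵀ) a b := by
    rw [hproj, hproj]
    simp only [ContinuousLinearMap.finsetSum_comp, ContinuousLinearMap.smul_comp, map_sum,
      map_smul, _root_.sum_apply, _root_.smul_apply, smul_eq_mul, hR, Matrix.mul_apply,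
      transpose_apply, Finset.mul_sum, Finset.sum_mul]
    refine Finset.sum_congr rfl fun i _ => Finset.sum_congr rfl fun j _ => by ring
  have h := congrArg (fun T => secondMoment P G
    ((EuclideanSpace.proj a : StrongDual ℝ (EuclideanSpace ℝ (Fin n))).comp T)
    ((EuclideanSpace.proj b : StrongDual ℝ (EuclideanSpace ℝ (Fin n))).comp T)) hsum
  simp only [ContinuousLinearMap.comp_add, map_add, _root_.add_apply] at h
  rw [hR', hRZ, secondMoment_comm hG _ (((EuclideanSpace.proj b :
    StrongDual ℝ (EuclideanSpace ℝ (Fin n)))).comp R'), hRZ, ← ContinuousLinearMap.comp_assoc,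
    ← ContinuousLinearMap.comp_assoc, hAR, hQ, hWR, secondMoment_comm hG _
    (((EuclideanSpace.proj b : StrongDual ℝ (EuclideanSpace ℝ (Fin n)))).comp (W N)), hWR] at h
  rw [Matrix.sub_apply, lyapunov, Matrix.add_apply]
  linarith

end LinearModel

end RemoteEstimation

namespace RemoteEstimation

/-! ### The plant as a Gaussian vector, and the law of the filter innovation. -/

section Innovation

variable {n m : ℕ} {Ω : Type*}
  {A Qw P0 Pbar : Matrix (Fin n) (Fin n) ℝ} {C : Matrix (Fin m) (Fin n) ℝ}
  {R : Matrix (Fin m) (Fin m) ℝ} {x0 : Ω → EuclideanSpace ℝ (Fin n)}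
  {w : ℕ → Ω → EuclideanSpace ℝ (Fin n)} {v : ℕ → Ω → EuclideanSpace ℝ (Fin m)}

/-- The space of the initial state and the noises up to time `N + 1`. -/
abbrev NoiseSpace (n m N : ℕ) : Type :=
  EuclideanSpace ℝ (Fin n) × ((Fin (N + 1) → EuclideanSpace ℝ (Fin n)) ×
    (Fin (N + 2) → EuclideanSpace ℝ (Fin m)))

/-- The initial state and the noises up to time `N + 1` as one random vector. -/
def noiseVector (x0 : Ω → EuclideanSpace ℝ (Fin n)) (w : ℕ → Ω → EuclideanSpace ℝ (Fin n))
    (v : ℕ → Ω → EuclideanSpace ℝ (Fin m)) (N : ℕ) (ω : Ω) : NoiseSpace n m N :=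
  (x0 ω, (fun j => w j ω, fun j => v j ω))

noncomputable def initMap (n m N : ℕ) : NoiseSpace n m N →L[ℝ] EuclideanSpace ℝ (Fin n) :=
  ContinuousLinearMap.fst ℝ _ _

/-- Indices outside the truncation get the zero map, so that `stateMap` can be fed a sequence
indexed by all of `ℕ`. -/
noncomputable def stateNoiseMap (n m N j : ℕ) :
    NoiseSpace n m N →L[ℝ] EuclideanSpace ℝ (Fin n) :=
  if h : j < N + 1 then
    ((ContinuousLinearMap.proj (⟨j, h⟩ : Fin (N + 1))).comp (ContinuousLinearMap.fst ℝ _ _)).comp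
      (ContinuousLinearMap.snd ℝ _ _)
  else 0

/-- One index more than for the state noise: `y_{N+1}` involves `v_{N+1}`, while `x_{N+1}` stops at
`w_N`. -/
noncomputable def obsNoiseMap (n m N j : ℕ) :
    NoiseSpace n m N →L[ℝ] EuclideanSpace ℝ (Fin m) :=
  if h : j < N + 2 then
    ((ContinuousLinearMap.proj (⟨j, h⟩ : Fin (N + 2))).comp (ContinuousLinearMap.snd ℝ _ _)).comp
      (ContinuousLinearMap.snd ℝ _ _)
  else 0

theorem initMap_noiseVector (N : ℕ) (ω : Ω) : initMap n m N (noiseVector x0 w v N ω) = x0 ω := rfl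

theorem stateNoiseMap_noiseVector {N j : ℕ} (h : j ≤ N) (ω : Ω) :
    stateNoiseMap n m N j (noiseVector x0 w v N ω) = w j ω := by
  rw [stateNoiseMap, dif_pos (by omega)]
  rfl

theorem obsNoiseMap_noiseVector {N j : ℕ} (h : j ≤ N + 1) (ω : Ω) :
    obsNoiseMap n m N j (noiseVector x0 w v N ω) = v j ω := by
  rw [obsNoiseMap, dif_pos (by omega)]
  rfl

theorem stateMap_noiseVector {N k : ℕ} (h : k ≤ N + 1) (ω : Ω) :
    stateMap A (initMap n m N) (stateNoiseMap n m N) k (noiseVector x0 w v N ω)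
      = state A x0 w k ω := by
  induction k with
  | zero => rfl
  | succ k ih =>
    rw [stateMap, state, _root_.add_apply, ContinuousLinearMap.comp_apply, ih (by omega),
      stateNoiseMap_noiseVector (by omega)]
    rfl

theorem historyMap_noiseVector {N k : ℕ} (h : k ≤ N + 1) (ω : Ω) :
    historyMap A C (initMap n m N) (stateNoiseMap n m N) (obsNoiseMap n m N) k
      (noiseVector x0 w v N ω) = fun j : Finset.Icc 1 k => measurement A C x0 w v j ω := by
  funext j
  have hj := (Finset.mem_Icc.1 j.2).2
  change toEuclideanLin C (stateMap A (initMap n m N) (stateNoiseMap n m N) j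
    (noiseVector x0 w v N ω)) + obsNoiseMap n m N j (noiseVector x0 w v N ω) = _
  rw [stateMap_noiseVector (by omega), obsNoiseMap_noiseVector (by omega)]
  rfl

/-- Presents the information as that of a single vector, as `condExp_of_regression` requires. -/
theorem measurementSigma_eq_comap (y : ℕ → Ω → EuclideanSpace ℝ (Fin m)) (k : ℕ) :
    measurementSigma y k
      = MeasurableSpace.comap (fun ω (j : Finset.Icc 1 k) => y j ω) inferInstance := by
  change _ = MeasurableSpace.comap _ MeasurableSpace.pi
  simp only [MeasurableSpace.pi, MeasurableSpace.comap_iSup, MeasurableSpace.comap_comp]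
  rw [measurementSigma, iSup_subtype']
  rfl

variable [MeasurableSpace Ω] {P : Measure Ω}

theorem IsGaussianPlant.measurable_noiseVector (h : IsGaussianPlant P P0 Qw R x0 w v) (N : ℕ) :
    Measurable (noiseVector x0 w v N) :=
  h.measurable_init.prodMk
    ((measurable_pi_lambda _ fun j : Fin (N + 1) => h.measurable_state j).prodMk
      (measurable_pi_lambda _ fun j : Fin (N + 2) => h.measurable_obs j))

theorem IsGaussianPlant.hasGaussianLaw (h : IsGaussianPlant P P0 Qw R x0 w v) (N : ℕ) :
    HasGaussianLaw (noiseVector x0 w v N) P := by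
  have hw : HasGaussianLaw (fun ω (j : Fin (N + 1)) => w j ω) P :=
    (h.indep_state.precomp Fin.val_injective).hasGaussianLaw fun j =>
      (h.law_state j).hasGaussianLaw
  have hv : HasGaussianLaw (fun ω (j : Fin (N + 2)) => v j ω) P :=
    (h.indep_obs.precomp Fin.val_injective).hasGaussianLaw fun j =>
      (h.law_obs j).hasGaussianLaw
  have hwv := (h.indep_state_obs.comp
    (φ := fun (f : ℕ → EuclideanSpace ℝ (Fin n)) (j : Fin (N + 1)) => f j)
    (ψ := fun (f : ℕ → EuclideanSpace ℝ (Fin m)) (j : Fin (N + 2)) => f j)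
    (by fun_prop) (by fun_prop)).hasGaussianLaw hw hv
  exact (h.indep_init.comp (φ := id) (ψ := fun f : (ℕ → EuclideanSpace ℝ (Fin n)) ×
    (ℕ → EuclideanSpace ℝ (Fin m)) => ((fun j : Fin (N + 1) => f.1 j),
      (fun j : Fin (N + 2) => f.2 j))) measurable_id (by fun_prop)).hasGaussianLaw
    h.law_init.hasGaussianLaw hwv

theorem integral_eq_zero_of_hasLaw {d : ℕ} {X : Ω → EuclideanSpace ℝ (Fin d)}
    {S : Matrix (Fin d) (Fin d) ℝ} (h : HasLaw X (multivariateGaussian 0 S) P) :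
    ∫ ω, X ω ∂P = 0 := by
  rw [h.integral_eq, integral_id_multivariateGaussian]

theorem IsGaussianPlant.integral_eq_zero (h : IsGaussianPlant P P0 Qw R x0 w v) (N : ℕ)
    (L : StrongDual ℝ (NoiseSpace n m N)) : ∫ ω, L (noiseVector x0 w v N ω) ∂P = 0 := by
  have hG := h.hasGaussianLaw N
  rw [ContinuousLinearMap.integral_comp_comm _ hG.integrable]
  have h1 := hG.integrable
  have h0 : ∫ ω, noiseVector x0 w v N ω ∂P = 0 := by
    refine Prod.ext ?_ (Prod.ext ?_ ?_)
    · rw [fst_integral h1]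
      exact integral_eq_zero_of_hasLaw h.law_init
    · rw [snd_integral h1, fst_integral h1.snd]
      funext j
      rw [eval_integral fun j => (h1.snd.fst).eval j]
      exact integral_eq_zero_of_hasLaw (h.law_state j)
    · rw [snd_integral h1, snd_integral h1.snd]
      funext j
      rw [eval_integral fun j => (h1.snd.snd).eval j]
      exact integral_eq_zero_of_hasLaw (h.law_obs j)
  rw [h0, map_zero]

theorem integral_mul_eq_zero_of_indepFun {E F : Type*} [NormedAddCommGroup E] [NormedSpace ℝ E]
    [MeasurableSpace E] [BorelSpace E] [CompleteSpace E] [SecondCountableTopology E]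
    [NormedAddCommGroup F] [NormedSpace ℝ F] [MeasurableSpace F] [BorelSpace F]
    [SecondCountableTopology F]
    {X : Ω → E} {Y : Ω → F} (hX : HasGaussianLaw X P) (hY : AEMeasurable Y P)
    (hX0 : ∫ ω, X ω ∂P = 0) (hXY : IndepFun X Y P) (l : StrongDual ℝ E) (l' : StrongDual ℝ F) :
    ∫ ω, l (X ω) * l' (Y ω) ∂P = 0 := by
  have h := (hXY.comp l.measurable l'.measurable).integral_fun_mul_eq_mul_integral
    (l.continuous.measurable.comp_aemeasurable hX.aemeasurable).aestronglyMeasurable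
    (l'.continuous.measurable.comp_aemeasurable hY).aestronglyMeasurable
  simp only [Function.comp_def] at h
  rw [h, ContinuousLinearMap.integral_comp_comm _ hX.integrable, hX0, map_zero, zero_mul]

theorem IsGaussianPlant.uncorrelated_init (h : IsGaussianPlant P P0 Qw R x0 w v) (N : ℕ) :
    Uncorrelated P (noiseVector x0 w v N) (stateNoiseMap n m N N) (initMap n m N) := by
  intro l l'
  rw [secondMoment_apply (h.hasGaussianLaw N)]
  simp only [ContinuousLinearMap.comp_apply, stateNoiseMap_noiseVector le_rfl, initMap_noiseVector]
  exact integral_mul_eq_zero_of_indepFun (h.law_state N).hasGaussianLaw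
    h.measurable_init.aemeasurable (integral_eq_zero_of_hasLaw (h.law_state N))
    ((h.indep_init.comp (φ := id) (ψ := fun f : (ℕ → EuclideanSpace ℝ (Fin n)) ×
      (ℕ → EuclideanSpace ℝ (Fin m)) => f.1 N) measurable_id (by fun_prop)).symm) l l'

theorem IsGaussianPlant.uncorrelated_state (h : IsGaussianPlant P P0 Qw R x0 w v) (N : ℕ) :
    ∀ j < N, Uncorrelated P (noiseVector x0 w v N) (stateNoiseMap n m N N)
      (stateNoiseMap n m N j) := by
  intro j hj l l'
  rw [secondMoment_apply (h.hasGaussianLaw N)]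
  simp only [ContinuousLinearMap.comp_apply, stateNoiseMap_noiseVector le_rfl,
    stateNoiseMap_noiseVector hj.le]
  exact integral_mul_eq_zero_of_indepFun (h.law_state N).hasGaussianLaw
    (h.measurable_state j).aemeasurable (integral_eq_zero_of_hasLaw (h.law_state N))
    (h.indep_state.indepFun hj.ne') l l'

theorem IsGaussianPlant.uncorrelated_obs (h : IsGaussianPlant P P0 Qw R x0 w v) (N : ℕ) :
    ∀ j ≤ N, Uncorrelated P (noiseVector x0 w v N) (stateNoiseMap n m N N)
      (obsNoiseMap n m N j) := by
  intro j hj l l'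
  rw [secondMoment_apply (h.hasGaussianLaw N)]
  simp only [ContinuousLinearMap.comp_apply, stateNoiseMap_noiseVector le_rfl,
    obsNoiseMap_noiseVector (show j ≤ N + 1 by omega)]
  exact integral_mul_eq_zero_of_indepFun (h.law_state N).hasGaussianLaw
    (h.measurable_obs j).aemeasurable (integral_eq_zero_of_hasLaw (h.law_state N))
    (h.indep_state_obs.comp (φ := fun f : ℕ → EuclideanSpace ℝ (Fin n) => f N)
      (ψ := fun f : ℕ → EuclideanSpace ℝ (Fin m) => f j) (by fun_prop) (by fun_prop))
    l l'

theorem IsGaussianPlant.secondMoment_state (h : IsGaussianPlant P P0 Qw R x0 w v) (N : ℕ)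
    (a b : Fin n) :
    secondMoment P (noiseVector x0 w v N)
      ((EuclideanSpace.proj a : StrongDual ℝ (EuclideanSpace ℝ (Fin n))).comp
        (stateNoiseMap n m N N))
      ((EuclideanSpace.proj b : StrongDual ℝ (EuclideanSpace ℝ (Fin n))).comp
        (stateNoiseMap n m N N)) = Qw a b := by
  rw [← covariance_eq_secondMoment (h.hasGaussianLaw N) (h.integral_eq_zero N)]
  simp only [ContinuousLinearMap.comp_apply, stateNoiseMap_noiseVector le_rfl]
  rw [← covariance_eval_multivariateGaussian (μ := 0) h.posSemidef_state a b,
    ← (h.law_state N).map_eq, covariance_map_fun (by fun_prop) (by fun_prop)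
      (h.measurable_state N).aemeasurable]
  rfl

theorem measurable_state (h : IsGaussianPlant P P0 Qw R x0 w v) (k : ℕ) :
    Measurable (state A x0 w k) := by
  induction k with
  | zero => exact h.measurable_init
  | succ k ih =>
    exact ((toEuclideanLin A).toContinuousLinearMap.measurable.comp ih).add (h.measurable_state k)

theorem measurable_measurement (h : IsGaussianPlant P P0 Qw R x0 w v) (k : ℕ) :
    Measurable (measurement A C x0 w v k) :=
  ((toEuclideanLin C).toContinuousLinearMap.measurable.comp (measurable_state h k)).add
    (h.measurable_obs k)

theorem measurementSigma_le (h : IsGaussianPlant P P0 Qw R x0 w v) (k : ℕ) :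
    measurementSigma (measurement A C x0 w v) k ≤ ‹MeasurableSpace Ω› :=
  iSup₂_le fun j _ => (measurable_measurement h j).comap_le

/-- Tower property: only this unconditional form of the steady-state assumption is used afterwards.
-/
theorem integral_error_mul_error [IsProbabilityMeasure P]
    (h : IsGaussianPlant P P0 Qw R x0 w v)
    {x : ℕ → Ω → EuclideanSpace ℝ (Fin n)}
    (hsteady : IsSteadyState P x (measurement A C x0 w v) Pbar) (k : ℕ) (i j : Fin n) :
    ∫ ω, (x k ω i - localEstimate P x (measurement A C x0 w v) k ω i) *
      (x k ω j - localEstimate P x (measurement A C x0 w v) k ω j) ∂P = Pbar i j := by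
  rw [← integral_condExp (measurementSigma_le h k), integral_congr_ae (hsteady k i j)]
  simp

/-- The sensor's estimate is a linear function of the measurements. -/
theorem exists_localEstimate_eq (h : IsGaussianPlant P P0 Qw R x0 w v) {N k : ℕ}
    (hk : k ≤ N + 1) :
    ∃ K : (Finset.Icc 1 k → EuclideanSpace ℝ (Fin m)) →L[ℝ] EuclideanSpace ℝ (Fin n),
      Uncorrelated P (noiseVector x0 w v N)
        (errorMap A C (initMap n m N) (stateNoiseMap n m N) (obsNoiseMap n m N) k K)
        (historyMap A C (initMap n m N) (stateNoiseMap n m N) (obsNoiseMap n m N) k) ∧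
      localEstimate P (state A x0 w) (measurement A C x0 w v) k =ᵐ[P] fun ω =>
        K (historyMap A C (initMap n m N) (stateNoiseMap n m N) (obsNoiseMap n m N) k
          (noiseVector x0 w v N ω)) := by
  obtain ⟨K, hK⟩ := exists_euclidean_regression (P := P) (G := noiseVector x0 w v N)
    (historyMap A C (initMap n m N) (stateNoiseMap n m N) (obsNoiseMap n m N) k)
    (stateMap A (initMap n m N) (stateNoiseMap n m N) k)
  refine ⟨K, hK, ?_⟩
  have := condExp_of_regression (h.hasGaussianLaw N) (h.measurable_noiseVector N)
    (h.integral_eq_zero N) _ _ K hK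
  simp only [historyMap_noiseVector hk, stateMap_noiseVector hk] at this ⊢
  rw [localEstimate, measurementSigma_eq_comap]
  exact this

/-- The innovation of the local filter is Gaussian with covariance `h(Pbar) - Pbar` and independent
of the past measurements. -/
theorem innovation_law (h : IsGaussianPlant P P0 Qw R x0 w v)
    (hsteady : IsSteadyState P (state A x0 w) (measurement A C x0 w v) Pbar) (N : ℕ) :
    (lyapunov A Qw Pbar - Pbar).PosSemidef ∧
    P.map (fun ω => localEstimate P (state A x0 w) (measurement A C x0 w v) (N + 1) ω -
        toEuclideanLin A (localEstimate P (state A x0 w) (measurement A C x0 w v) N ω))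
      = multivariateGaussian 0 (lyapunov A Qw Pbar - Pbar) ∧
    Indep (MeasurableSpace.comap (fun ω =>
        localEstimate P (state A x0 w) (measurement A C x0 w v) (N + 1) ω -
        toEuclideanLin A (localEstimate P (state A x0 w) (measurement A C x0 w v) N ω))
        inferInstance) (measurementSigma (measurement A C x0 w v) N) P := by
  have hG := h.hasGaussianLaw N
  have hG0 := h.integral_eq_zero N
  have := hG.isProbabilityMeasure
  obtain ⟨K, hK, hKe⟩ := exists_localEstimate_eq (A := A) (C := C) h (Nat.le_succ N)
  obtain ⟨K', hK', hKe'⟩ := exists_localEstimate_eq (A := A) (C := C) h (le_refl (N + 1))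
  have hWX := secondMoment_noise_state (A := A) (h.uncorrelated_init N) (h.uncorrelated_state N)
    N le_rfl
  have hWY := secondMoment_noise_history (A := A) (C := C) (h.uncorrelated_init N)
    (h.uncorrelated_state N) (h.uncorrelated_obs N)
  have herr : ∀ k ≤ N + 1, ∀ (L : (Finset.Icc 1 k → EuclideanSpace ℝ (Fin m)) →L[ℝ]
      EuclideanSpace ℝ (Fin n)),
      (localEstimate P (state A x0 w) (measurement A C x0 w v) k =ᵐ[P] fun ω =>
        L (historyMap A C (initMap n m N) (stateNoiseMap n m N) (obsNoiseMap n m N) k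
          (noiseVector x0 w v N ω))) → ∀ a b, secondMoment P (noiseVector x0 w v N)
      ((EuclideanSpace.proj a : StrongDual ℝ (EuclideanSpace ℝ (Fin n))).comp
        (errorMap A C (initMap n m N) (stateNoiseMap n m N) (obsNoiseMap n m N) k L))
      ((EuclideanSpace.proj b : StrongDual ℝ (EuclideanSpace ℝ (Fin n))).comp
        (errorMap A C (initMap n m N) (stateNoiseMap n m N) (obsNoiseMap n m N) k L))
        = Pbar a b := by
    intro k hk L hL a b
    rw [secondMoment_apply hG, ← integral_error_mul_error h hsteady k a b]
    refine integral_congr_ae ?_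
    filter_upwards [hL] with ω hω
    rw [hω]
    simp [stateMap_noiseVector hk]
  have hcov := secondMoment_innovation hG hWX hWY (h.secondMoment_state N) hK'
    (herr N (Nat.le_succ N) K hKe) (herr (N + 1) le_rfl K' hKe')
  have hind := indepFun_of_secondMoment_eq_zero hG hG0 _ _
    (secondMoment_innovation_history hWY hK hK')
  set Z := innovationMap A C (initMap n m N) (stateNoiseMap n m N) (obsNoiseMap n m N) N K K'
    with hZ
  have hZe : (fun ω => localEstimate P (state A x0 w) (measurement A C x0 w v) (N + 1) ω -
      toEuclideanLin A (localEstimate P (state A x0 w) (measurement A C x0 w v) N ω))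
      =ᵐ[P] fun ω => Z (noiseVector x0 w v N ω) := by
    filter_upwards [hKe, hKe'] with ω h1 h2
    rw [h1, h2]
    rfl
  -- The variance of `Z` in direction `t`. It yields both positive semidefiniteness and the
  -- characteristic function of `Z`.
  have hquad : ∀ t : EuclideanSpace ℝ (Fin n), secondMoment P (noiseVector x0 w v N)
      ((innerSL ℝ t).comp Z) ((innerSL ℝ t).comp Z)
      = t.ofLp ⬝ᵥ ((lyapunov A Qw Pbar - Pbar) *ᵥ t.ofLp) := by
    intro t
    rw [secondMoment_comp_left, dotProduct]
    refine Finset.sum_congr rfl fun i _ => ?_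
    rw [secondMoment_comm hG _ ((innerSL ℝ t).comp Z), secondMoment_comp_left, mulVec, dotProduct]
    simp_rw [secondMoment_comm hG _ ((EuclideanSpace.proj i :
      StrongDual ℝ (EuclideanSpace ℝ (Fin n))).comp Z), hcov]
    have hin : ∀ j, innerSL ℝ t (EuclideanSpace.single j 1) = t.ofLp j := fun j => by
      simp [EuclideanSpace.inner_single_right]
    simp_rw [hin, mul_comm]
  have hpsd : (lyapunov A Qw Pbar - Pbar).PosSemidef := by
    refine PosSemidef.of_dotProduct_mulVec_nonneg ?_ fun t => ?_
    · ext i j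
      rw [conjTranspose_apply, star_trivial, ← hcov, ← hcov, secondMoment_comm hG]
    · have := hquad (WithLp.toLp 2 t)
      rw [secondMoment_apply hG] at this
      simp only [star_trivial]
      rw [← this]
      exact integral_nonneg fun ω => mul_self_nonneg _
  refine ⟨hpsd, ?_, ?_⟩
  · rw [Measure.map_congr hZe]
    have hZG := hG.map_fun Z
    have := hZG.isGaussian_map
    refine Measure.ext_of_charFun (funext fun t => ?_)
    have h1 := hG0 ((innerSL ℝ t).comp Z)
    have h2 := covariance_eq_secondMoment hG hG0 ((innerSL ℝ t).comp Z) ((innerSL ℝ t).comp Z)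
    rw [covariance_self (by fun_prop), hquad] at h2
    simp only [ContinuousLinearMap.comp_apply, innerSL_apply_apply] at h1 h2
    rw [charFun_multivariateGaussian hpsd, hZG.charFun_map_eq, h1, h2]
    simp
  · rw [measurementSigma_eq_comap]
    simp only [historyMap_noiseVector (Nat.le_succ N)] at hind
    exact hind.congr hZe.symm (ae_eq_refl _)

end Innovation

end RemoteEstimation

namespace RemoteEstimation

/-! ### Recursions for the holding time and the incremental innovation. -/

section Recursion

variable {Ω : Type*} {n m : ℕ} {γ : ℕ → Ω → Fin 2}

theorem holdingTime_le (γ : ℕ → Ω → Fin 2) (k : ℕ) (ω : Ω) : holdingTime γ k ω ≤ k :=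
  Nat.sub_le _ _

theorem holdingTime_succ_of_eq_one {k : ℕ} {ω : Ω} (h : γ k ω = 1) :
    holdingTime γ (k + 1) ω = 1 := by
  have hs : ((Finset.range (k + 1)).filter (fun t => γ t ω = 1)).sup id = k := by
    refine le_antisymm (Finset.sup_le fun t ht => ?_) (Finset.le_sup (f := id) ?_)
    · simp only [Finset.mem_filter, Finset.mem_range] at ht
      exact Nat.lt_succ_iff.1 ht.1
    · simp [h]
  rw [holdingTime, hs]
  omega

theorem holdingTime_succ_of_ne_one {k : ℕ} {ω : Ω} (h : γ k ω ≠ 1) :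
    holdingTime γ (k + 1) ω = holdingTime γ k ω + 1 := by
  -- With the last reception time at most `k`, the truncated subtraction commutes with adding one.
  have hs : ((Finset.range k).filter (fun t => γ t ω = 1)).sup id ≤ k :=
    Finset.sup_le fun t ht => by
      simp only [Finset.mem_filter, Finset.mem_range] at ht
      exact ht.1.le
  rw [holdingTime, holdingTime, Finset.range_add_one, Finset.filter_insert, if_neg h]
  omega

theorem holdingTime_pos (γ : ℕ → Ω → Fin 2) (k : ℕ) (ω : Ω) : 1 ≤ holdingTime γ (k + 1) ω := by
  by_cases h : γ k ω = 1
  · rw [holdingTime_succ_of_eq_one h]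
  · rw [holdingTime_succ_of_ne_one h]
    omega

variable {A : Matrix (Fin n) (Fin n) ℝ} {xs : ℕ → Ω → EuclideanSpace ℝ (Fin n)}

/-- The one-step innovation of the local estimates. -/
noncomputable def stepInnovation (A : Matrix (Fin n) (Fin n) ℝ)
    (xs : ℕ → Ω → EuclideanSpace ℝ (Fin n)) (N : ℕ) (ω : Ω) : EuclideanSpace ℝ (Fin n) :=
  xs (N + 1) ω - toEuclideanLin A (xs N ω)

theorem innovation_zero (ω : Ω) : innovation A xs γ 0 ω = 0 := by
  simp [innovation, holdingTime]

theorem innovation_succ_of_eq_one {k : ℕ} {ω : Ω} (h : γ k ω = 1) :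
    innovation A xs γ (k + 1) ω = stepInnovation A xs k ω := by
  rw [innovation, holdingTime_succ_of_eq_one h, pow_one, stepInnovation, Nat.add_sub_cancel]

/-- The reference time `k - τ(k)` does not move at a drop; inserting `A x̂_k` splits off the
one-step innovation. -/
theorem innovation_succ_of_ne_one {k : ℕ} {ω : Ω} (h : γ k ω ≠ 1) :
    innovation A xs γ (k + 1) ω
      = toEuclideanLin A (innovation A xs γ k ω) + stepInnovation A xs k ω := by
  have hmul : ∀ (B : Matrix (Fin n) (Fin n) ℝ) (x : EuclideanSpace ℝ (Fin n)),
      toEuclideanLin (A * B) x = toEuclideanLin A (toEuclideanLin B x) := fun B x => by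
    simp [toLpLin_apply, mulVec_mulVec]
  rw [innovation, innovation, holdingTime_succ_of_ne_one h, stepInnovation, Nat.add_sub_add_right,
    pow_succ', map_sub, hmul]
  abel

theorem measurable_holdingTime {M : MeasurableSpace Ω} {k : ℕ}
    (hγ : ∀ j < k, Measurable[M] (γ j)) : Measurable[M] (holdingTime γ k) := by
  induction k with
  | zero =>
    have : holdingTime γ 0 = fun _ => 0 := by
      ext ω
      simp [holdingTime]
    rw [this]
    exact measurable_const
  | succ k ih =>
    have h : holdingTime γ (k + 1) = fun ω => if γ k ω = 1 then 1 else holdingTime γ k ω + 1 := by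
      ext ω
      split_ifs with h
      · exact holdingTime_succ_of_eq_one h
      · exact holdingTime_succ_of_ne_one h
    rw [h]
    exact Measurable.ite (hγ k (Nat.lt_succ_self k) (measurableSet_singleton 1)) measurable_const
      ((ih fun j hj => hγ j (by omega)).add_const 1)

theorem measurable_stepInnovation {M : MeasurableSpace Ω} {N : ℕ}
    (hxs : ∀ j ≤ N + 1, Measurable[M] (xs j)) : Measurable[M] (stepInnovation A xs N) :=
  (hxs _ le_rfl).sub ((toEuclideanLin A).toContinuousLinearMap.measurable.comp (hxs _ (by omega)))

theorem measurable_innovation {M : MeasurableSpace Ω} {k : ℕ}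
    (hxs : ∀ j ≤ k, Measurable[M] (xs j)) (hγ : ∀ j < k, Measurable[M] (γ j)) :
    Measurable[M] (innovation A xs γ k) := by
  induction k with
  | zero =>
    have : innovation A xs γ 0 = fun _ => 0 := funext fun ω => innovation_zero ω
    rw [this]
    exact measurable_const
  | succ k ih =>
    have h : innovation A xs γ (k + 1) = fun ω => if γ k ω = 1 then stepInnovation A xs k ω
        else toEuclideanLin A (innovation A xs γ k ω) + stepInnovation A xs k ω := by
      ext1 ω
      split_ifs with h
      · exact innovation_succ_of_eq_one h
      · exact innovation_succ_of_ne_one h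
    rw [h]
    exact Measurable.ite (hγ k (Nat.lt_succ_self k) (measurableSet_singleton 1))
      (measurable_stepInnovation hxs)
      (((toEuclideanLin A).toContinuousLinearMap.measurable.comp
        (ih (fun j hj => hxs j (by omega)) fun j hj => hγ j (by omega))).add
          (measurable_stepInnovation hxs))

theorem measurable_powerEF {M : MeasurableSpace Ω} {k : ℕ} {𝒬 : ℕ → Matrix (Fin n) (Fin n) ℝ}
    {N₀ W α b : ℝ}
    (hxs : ∀ j ≤ k, Measurable[M] (xs j)) (hγ : ∀ j < k, Measurable[M] (γ j)) :
    Measurable[M] (powerEF A 𝒬 N₀ W α b xs γ k) := by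
  have h : Measurable fun p : EuclideanSpace ℝ (Fin n) × ℕ => quadCost p.1 (𝒬 p.2) :=
    measurable_from_prod_countable_left fun t => (continuous_quadCost (𝒬 t)).measurable
  exact ((h.comp ((measurable_innovation hxs hγ).prodMk (measurable_holdingTime hγ))).const_mul
    _).add_const _

end Recursion

/-! ### Traces of σ-algebras on an event. -/

section Trace

variable {Ω β : Type*} [MeasurableSpace β]

/-- Adjoining a function that is constant on `S` does not change the trace of a σ-algebra on
`S`. -/
theorem exists_measurableSet_inter_eq {M : MeasurableSpace Ω} {f : Ω → β} {S : Set Ω}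
    (hf : ∀ ω ∈ S, ∀ ω' ∈ S, f ω = f ω') {D : Set Ω}
    (hD : MeasurableSet[M ⊔ MeasurableSpace.comap f inferInstance] D) :
    ∃ D', MeasurableSet[M] D' ∧ D ∩ S = D' ∩ S := by
  rw [MeasurableSpace.measurableSet_sup] at hD
  induction hD with
  | basic s hs =>
    rcases hs with hs | ⟨T, -, rfl⟩
    · exact ⟨s, hs, rfl⟩
    · by_cases h : ∃ ω ∈ S, f ω ∈ T
      · obtain ⟨ω, hω, hT⟩ := h
        refine ⟨Set.univ, MeasurableSet.univ, ?_⟩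
        rw [Set.univ_inter, Set.inter_eq_right]
        intro ω' hω'
        rw [Set.mem_preimage, hf ω' hω' ω hω]
        exact hT
      · refine ⟨∅, MeasurableSet.empty, ?_⟩
        rw [Set.empty_inter]
        ext ω
        simp only [Set.mem_inter_iff, Set.mem_preimage, Set.mem_empty_iff_false, iff_false]
        exact fun hω => h ⟨ω, hω.2, hω.1⟩
  | empty => exact ⟨∅, MeasurableSet.empty, rfl⟩
  | compl s _ ih =>
    obtain ⟨D', hD', h⟩ := ih
    refine ⟨D'ᶜ, hD'.compl, ?_⟩
    ext ω
    have := Set.ext_iff.1 h ω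
    simp only [Set.mem_inter_iff, Set.mem_compl_iff] at this ⊢
    tauto
  | iUnion s _ ih =>
    choose D' hD' h using ih
    refine ⟨⋃ i, D' i, MeasurableSet.iUnion hD', ?_⟩
    rw [Set.iUnion_inter, Set.iUnion_inter]
    exact Set.iUnion_congr h

end Trace

/-! ### Propagation of a Gaussian law through one step of the dynamics. -/

section GaussianStep

variable {n : ℕ}

theorem map_prod_multivariateGaussian {A S T : Matrix (Fin n) (Fin n) ℝ} (hS : S.PosSemidef)
    (hT : T.PosSemidef) :
    ((multivariateGaussian 0 S).prod (multivariateGaussian 0 T)).map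
      (fun p : EuclideanSpace ℝ (Fin n) × EuclideanSpace ℝ (Fin n) => toEuclideanLin A p.1 + p.2)
      = multivariateGaussian 0 (A * S * Aᵀ + T) := by
  have hASA : (A * S * Aᵀ).PosSemidef := by
    have := hS.mul_mul_conjTranspose_same A
    rwa [conjTranspose_eq_transpose_of_trivial] at this
  have hA : Measurable fun x => toEuclideanLin A x :=
    (toEuclideanLin A).toContinuousLinearMap.measurable
  have hf : Measurable fun p : EuclideanSpace ℝ (Fin n) × EuclideanSpace ℝ (Fin n) =>
      toEuclideanLin A p.1 + p.2 := (hA.comp measurable_fst).add measurable_snd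
  have := Measure.isProbabilityMeasure_map
    (μ := (multivariateGaussian 0 S).prod (multivariateGaussian 0 T)) hf.aemeasurable
  refine Measure.ext_of_charFun (funext fun t => ?_)
  rw [charFun_multivariateGaussian (hASA.add hT), charFun_apply,
    integral_map hf.aemeasurable (Measurable.aestronglyMeasurable (by fun_prop))]
  have h1 : ∀ p : EuclideanSpace ℝ (Fin n) × EuclideanSpace ℝ (Fin n),
      Complex.exp (inner ℝ (toEuclideanLin A p.1 + p.2) t * Complex.I)
      = Complex.exp (inner ℝ p.1 (WithLp.toLp 2 (Aᵀ *ᵥ t.ofLp)) * Complex.I) *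
        Complex.exp (inner ℝ p.2 t * Complex.I) := by
    intro p
    have h2 : inner ℝ (toEuclideanLin A p.1) t
        = inner ℝ p.1 (WithLp.toLp 2 (Aᵀ *ᵥ t.ofLp)) := by
      rw [EuclideanSpace.inner_eq_star_dotProduct, EuclideanSpace.inner_eq_star_dotProduct]
      simp only [star_trivial, toLpLin_apply]
      rw [dotProduct_mulVec, ← mulVec_transpose]
    rw [inner_add_left, h2, ← Complex.exp_add]
    push_cast
    ring_nf
  simp_rw [h1]
  rw [integral_prod_mul (fun x => Complex.exp (inner ℝ x (WithLp.toLp 2 (Aᵀ *ᵥ t.ofLp)) *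
    Complex.I)) (fun x => Complex.exp (inner ℝ x t * Complex.I)), ← charFun_apply,
    ← charFun_apply, charFun_multivariateGaussian hS, charFun_multivariateGaussian hT,
    ← Complex.exp_add]
  have h3 : (Aᵀ *ᵥ t.ofLp) ⬝ᵥ (S *ᵥ (Aᵀ *ᵥ t.ofLp)) = t.ofLp ⬝ᵥ ((A * S * Aᵀ) *ᵥ t.ofLp) := by
    rw [← mulVec_mulVec, ← mulVec_mulVec, dotProduct_mulVec t.ofLp, ← mulVec_transpose]
  rw [h3, add_mulVec, dotProduct_add]
  congr 1
  simp
  ring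

end GaussianStep

end RemoteEstimation

namespace RemoteEstimation

/-! ### Laws restricted to an independent event. -/

section Independence

variable {Ω E : Type*} {M mΩ : MeasurableSpace Ω} {P : Measure Ω} [MeasurableSpace E]

/-- The law of an independent pair, restricted to an event of the first σ-algebra. -/
theorem map_restrict_prod_of_indep [IsProbabilityMeasure P] {E' : Type*} [MeasurableSpace E']
    {X : Ω → E} {Z : Ω → E'} {B : Set Ω}
    (hM : M ≤ mΩ) (hX : Measurable[M] X) (hZ : Measurable Z)
    (hB : MeasurableSet[M] B) (h : Indep (MeasurableSpace.comap Z inferInstance) M P) :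
    (P.restrict B).map (fun ω => (X ω, Z ω)) = ((P.restrict B).map X).prod (P.map Z) := by
  have hX' : Measurable X := hX.mono hM le_rfl
  have := Measure.isProbabilityMeasure_map (μ := P) hZ.aemeasurable
  refine (Measure.prod_eq fun s t hs ht => ?_).symm
  rw [Measure.map_apply (hX'.prodMk hZ) (hs.prod ht), Measure.map_apply hX' hs,
    Measure.map_apply hZ ht, Measure.restrict_apply (hX'.prodMk hZ (hs.prod ht)),
    Measure.restrict_apply (hX' hs), mul_comm,
    ← (Indep_iff _ _ _).1 h _ _ ⟨t, ht, rfl⟩ ((hX hs).inter hB)]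
  congr 1
  ext ω
  simp only [Set.mem_inter_iff, Set.mem_preimage, Set.mem_prod]
  tauto

theorem map_restrict_of_indep {Z : Ω → E} {B : Set Ω}
    (hZ : Measurable Z)
    (hB : MeasurableSet[M] B) (h : Indep (MeasurableSpace.comap Z inferInstance) M P) :
    (P.restrict B).map Z = P B • P.map Z := by
  ext t ht
  rw [Measure.map_apply hZ ht, Measure.restrict_apply (hZ ht), Measure.smul_apply,
    Measure.map_apply hZ ht, smul_eq_mul, (Indep_iff _ _ _).1 h _ _ ⟨t, ht, rfl⟩ hB, mul_comm]

end Independence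

/-! ### Information of the remote estimator, and independence of future innovations. -/

section Channel

variable {n m : ℕ} {Ω : Type*}
  {x0 : Ω → EuclideanSpace ℝ (Fin n)} {w : ℕ → Ω → EuclideanSpace ℝ (Fin n)}
  {v : ℕ → Ω → EuclideanSpace ℝ (Fin m)} {y : ℕ → Ω → EuclideanSpace ℝ (Fin m)}
  {xs : ℕ → Ω → EuclideanSpace ℝ (Fin n)} {γ : ℕ → Ω → Fin 2}
  {A Qw Pbar : Matrix (Fin n) (Fin n) ℝ} {𝒬 : ℕ → Matrix (Fin n) (Fin n) ℝ}
  {N₀ W α b : ℝ}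

/-- The measurements up to time `N` and the arrivals before time `k`. -/
abbrev obsSigma (y : ℕ → Ω → EuclideanSpace ℝ (Fin m)) (γ : ℕ → Ω → Fin 2) (N k : ℕ) :
    MeasurableSpace Ω :=
  measurementSigma y N ⊔ ⨆ j ∈ Finset.range k, MeasurableSpace.comap (γ j) inferInstance

theorem measurementSigma_mono (y : ℕ → Ω → EuclideanSpace ℝ (Fin m)) {N N' : ℕ} (h : N ≤ N') :
    measurementSigma y N ≤ measurementSigma y N' :=
  biSup_mono fun _ hj => Finset.Icc_subset_Icc_right h hj

theorem measurable_arrival_obsSigma (y : ℕ → Ω → EuclideanSpace ℝ (Fin m)) {N k j : ℕ}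
    (h : j < k) : Measurable[obsSigma y γ N k] (γ j) := by
  rw [measurable_iff_comap_le]
  exact le_sup_of_le_right (le_biSup (fun j => MeasurableSpace.comap (γ j) inferInstance)
    (Finset.mem_range.2 h))

theorem measurable_estimate_obsSigma (hxs : ∀ k, Measurable[measurementSigma y k] (xs k))
    {N k j : ℕ} (h : j ≤ N) : Measurable[obsSigma y γ N k] (xs j) :=
  (hxs j).mono ((measurementSigma_mono y h).trans le_sup_left) le_rfl

theorem obsSigma_succ (y : ℕ → Ω → EuclideanSpace ℝ (Fin m)) (N k : ℕ) :
    obsSigma y γ N (k + 1) = obsSigma y γ N k ⊔ MeasurableSpace.comap (γ k) inferInstance := by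
  rw [obsSigma, obsSigma, Finset.range_add_one, Finset.iSup_insert, sup_assoc, sup_comm
    (MeasurableSpace.comap (γ k) inferInstance)]

theorem infoSigma_succ (k : ℕ) :
    infoSigma xs γ (k + 1) = infoSigma xs γ k ⊔
      MeasurableSpace.comap (fun ω => (((γ (k + 1) ω : ℕ) : ℝ) • xs (k + 1) ω, γ (k + 1) ω))
        inferInstance := by
  rw [infoSigma, infoSigma, ← Finset.insert_Icc_right_eq_Icc_add_one (by omega),
    Finset.iSup_insert, sup_comm]
  congr 1
  exact (MeasurableSpace.comap_prodMk _ _).symm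

theorem infoSigma_le_obsSigma (hxs : ∀ k, Measurable[measurementSigma y k] (xs k)) (k : ℕ) :
    infoSigma xs γ k ≤ obsSigma y γ k (k + 1) := by
  refine iSup₂_le fun j hj => sup_le ?_ ?_
  · have hj := (Finset.mem_Icc.1 hj).2
    have h1 : Measurable fun i : Fin 2 => ((i : ℕ) : ℝ) := measurable_of_finite _
    exact Measurable.comap_le ((h1.comp (measurable_arrival_obsSigma y
      (Nat.lt_succ_of_le hj))).smul (measurable_estimate_obsSigma hxs hj))
  · exact (measurable_arrival_obsSigma y
      (Nat.lt_succ_of_le (Finset.mem_Icc.1 hj).2)).comap_le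

theorem measurable_arrival_infoSigma {j k : ℕ} (h1 : 1 ≤ j) (h : j ≤ k) :
    Measurable[infoSigma xs γ k] (γ j) := by
  rw [measurable_iff_comap_le]
  exact le_sup_right.trans (le_biSup (fun j =>
    (MeasurableSpace.comap (fun ω => ((γ j ω : ℕ) : ℝ) • xs j ω) inferInstance ⊔
      MeasurableSpace.comap (γ j) inferInstance)) (Finset.mem_Icc.2 ⟨h1, h⟩))

/-- `γ_0` is not part of the remote information but is constant, so nothing is lost. -/
theorem measurable_holdingTime_infoSigma (hγ0 : ∀ ω, γ 0 ω = 1) (k : ℕ) :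
    Measurable[infoSigma xs γ k] (holdingTime γ (k + 1)) := by
  refine measurable_holdingTime fun j hj => ?_
  rcases Nat.eq_zero_or_pos j with rfl | h
  · rw [show γ 0 = fun _ => 1 from funext hγ0]
    exact measurable_const
  · exact measurable_arrival_infoSigma h (by omega)

variable [MeasurableSpace Ω] {P : Measure Ω}

/-- The conditional probability of a drop, integrated over an event of the past. -/
theorem measure_inter_drop [IsProbabilityMeasure P] {p : ℕ → Ω → ℝ}
    (hγ : IsChannel P x0 w v N₀ W α p γ) {k : ℕ} (hk : 1 ≤ k)
    (hpast : pastSigma x0 w v γ k ≤ ‹MeasurableSpace Ω›) {B : Set Ω}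
    (hB : MeasurableSet[pastSigma x0 w v γ k] B) :
    P (B ∩ {ω | γ k ω = 0})
      = ∫⁻ ω in B, ENNReal.ofReal (Real.exp (-α / (N₀ * W)) ^ p k ω) ∂P := by
  have hm : MeasurableSet {ω | γ k ω = 0} := hγ.measurable k (measurableSet_singleton 0)
  have hint : Integrable ({ω | γ k ω = 0}.indicator fun _ => (1 : ℝ)) P :=
    (integrable_const 1).indicator hm
  have h1 := setIntegral_condExp hpast hint hB
  have hi : Integrable (fun ω => Real.exp (-α / (N₀ * W)) ^ p k ω) P :=
    integrable_condExp.congr (hγ.drop k hk)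
  rw [setIntegral_congr_ae (g := fun ω => Real.exp (-α / (N₀ * W)) ^ p k ω) (hpast _ hB)
    ((hγ.drop k hk).mono fun ω h _ => h), setIntegral_indicator hm, setIntegral_const,
    smul_eq_mul, mul_one] at h1
  rw [← ofReal_integral_eq_lintegral_ofReal hi.integrableOn (ae_of_all _ fun ω => by positivity),
    h1, ofReal_measureReal]

/-- The next innovation is independent of the measurements and arrivals up to the present. -/
theorem indep_stepInnovation_obsSigma [IsProbabilityMeasure P]
    (hγ : IsChannel P x0 w v N₀ W α (powerEF A 𝒬 N₀ W α b xs γ) γ)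
    (hpast : ∀ k, pastSigma x0 w v γ k ≤ ‹MeasurableSpace Ω›)
    (hobs : ∀ N k, obsSigma y γ N k ≤ pastSigma x0 w v γ k)
    (hxs : ∀ k, Measurable[measurementSigma y k] (xs k)) {N : ℕ}
    (hind : Indep (MeasurableSpace.comap (stepInnovation A xs N) inferInstance)
      (measurementSigma y N) P) (k : ℕ) (hk : k ≤ N + 1) :
    Indep (MeasurableSpace.comap (stepInnovation A xs N) inferInstance) (obsSigma y γ N k) P := by
  induction k with
  | zero =>
    have : obsSigma y γ N 0 = measurementSigma y N := by simp [obsSigma]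
    rwa [this]
  | succ k ih =>
    have ih := ih (by omega)
    have hstep : MeasurableSpace.comap (stepInnovation A xs N) inferInstance
        ≤ pastSigma x0 w v γ k :=
      Measurable.comap_le (measurable_stepInnovation fun j hj =>
        (measurable_estimate_obsSigma hxs hj).mono (hobs (N + 1) k) le_rfl)
    have hS : MeasurableSet {ω | γ k ω = 0} := hγ.measurable k (measurableSet_singleton 0)
    -- The probability on the left is the integral of `q ^ ω_k` over `E ∩ D`. Since `ω_k` depends
    -- only on measurements up to `k ≤ N` and arrivals before `k`, the induction hypothesis pulls
    -- out `P E`.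
    have key : ∀ E D, MeasurableSet[MeasurableSpace.comap (stepInnovation A xs N) inferInstance] E →
        MeasurableSet[obsSigma y γ N k] D →
        P (E ∩ D ∩ {ω | γ k ω = 0}) = P E * P (D ∩ {ω | γ k ω = 0}) := by
      intro E D hE hD
      rcases Nat.eq_zero_or_pos k with rfl | hk0
      · have : {ω | γ 0 ω = 0} = ∅ := by
          ext ω
          simp [hγ.initial ω]
        simp [this]
      · have hE' := hstep _ hE
        have hD' := hobs N k _ hD
        rw [measure_inter_drop hγ hk0 (hpast k) (hE'.inter hD'),
          measure_inter_drop hγ hk0 (hpast k) hD', Set.inter_comm,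
          ← lintegral_indicator ((hpast k) _ (hD'.inter hE')),
          ← lintegral_indicator ((hpast k) _ hD')]
        have hp : Measurable[obsSigma y γ N k] fun ω =>
            ENNReal.ofReal (Real.exp (-α / (N₀ * W)) ^ powerEF A 𝒬 N₀ W α b xs γ k ω) := by
          refine ENNReal.measurable_ofReal.comp (Measurable.pow measurable_const ?_)
          exact measurable_powerEF
            (fun j hj => measurable_estimate_obsSigma hxs (by omega))
            (fun j hj => measurable_arrival_obsSigma y hj)
        have h1 := lintegral_mul_eq_lintegral_mul_lintegral_of_independent_measurableSpace
          (hstep.trans (hpast k)) ((hobs N k).trans (hpast k)) ih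
          (f := E.indicator fun _ => 1) (g := D.indicator fun ω =>
            ENNReal.ofReal (Real.exp (-α / (N₀ * W)) ^ powerEF A 𝒬 N₀ W α b xs γ k ω))
          (measurable_const.indicator hE) (hp.indicator hD)
        rw [lintegral_indicator ((hpast k) _ hE'), setLIntegral_one] at h1
        rw [← h1]
        refine lintegral_congr fun ω => ?_
        by_cases h2 : ω ∈ E <;> by_cases h3 : ω ∈ D <;> simp [h2, h3]
    rw [Indep_iff]
    intro E D hE hD
    rw [obsSigma_succ] at hD
    -- `γ_k` is constant on the drop event and on its complement, so on each piece `D` agrees with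
    -- an event not involving `γ_k`.
    obtain ⟨D0, hD0, h0⟩ := exists_measurableSet_inter_eq (S := {ω | γ k ω = 0})
      (fun ω h ω' h' => by
        rw [Set.mem_ofPred_eq] at h h'
        rw [h, h']) hD
    obtain ⟨D1, hD1, h1⟩ := exists_measurableSet_inter_eq (S := {ω | γ k ω = 0}ᶜ)
      (fun ω h ω' h' => by
        simp only [Set.mem_compl_iff, Set.mem_ofPred_eq] at h h'
        rw [Fin.eq_one_of_ne_zero _ h, Fin.eq_one_of_ne_zero _ h']) hD
    -- Reception is handled by subtracting the drop identity from the independence of `E` and `D1`;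
    -- the cancelled term is finite.
    have hcompl : P (E ∩ D1 ∩ {ω | γ k ω = 0}ᶜ) = P E * P (D1 ∩ {ω | γ k ω = 0}ᶜ) := by
      have e1 := measure_inter_add_sdiff (μ := P) (E ∩ D1) hS
      rw [key E D1 hE hD1, (Indep_iff _ _ _).1 ih _ _ hE hD1, ← measure_inter_add_sdiff D1 hS,
        mul_add] at e1
      exact (ENNReal.add_right_inj (by finiteness)).1 e1
    rw [← measure_inter_add_sdiff (E ∩ D) hS, ← measure_inter_add_sdiff D hS, Set.sdiff_eq,
      Set.sdiff_eq, h0, h1, Set.inter_assoc, h0, Set.inter_assoc E D, h1, ← Set.inter_assoc,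
      ← Set.inter_assoc, key E D0 hE hD0, hcompl, mul_add]

end Channel

end RemoteEstimation

namespace RemoteEstimation

/-! ### Positivity of `Σ_t` and `Ψ_t`, and the tilt factor. -/

section Posterior

variable {n m : ℕ} {A Qw Pbar : Matrix (Fin n) (Fin n) ℝ} {𝒬 : ℕ → Matrix (Fin n) (Fin n) ℝ}

theorem posSemidef_sigmaMat_of_psiMat (hS : (lyapunov A Qw Pbar - Pbar).PosSemidef) {t : ℕ}
    (h : (PsiMat A Qw Pbar 𝒬 (t - 1)).PosSemidef) : (SigmaMat A Qw Pbar 𝒬 t).PosSemidef := by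
  have := h.mul_mul_conjTranspose_same A
  rw [conjTranspose_eq_transpose_of_trivial] at this
  exact this.add hS

theorem psiMat_eq {t : ℕ} (ht : 1 ≤ t) :
    PsiMat A Qw Pbar 𝒬 t = pinv (𝒬 t + pinv (SigmaMat A Qw Pbar 𝒬 t)) := by
  obtain ⟨s, rfl⟩ := Nat.exists_eq_add_of_le' ht
  rfl

theorem posSemidef_psiMat (hS : (lyapunov A Qw Pbar - Pbar).PosSemidef)
    (h𝒬 : ∀ t, 1 ≤ t → (𝒬 t).PosSemidef) (t : ℕ) : (PsiMat A Qw Pbar 𝒬 t).PosSemidef := by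
  induction t with
  | zero => exact PosSemidef.zero
  | succ t ih =>
    rw [psiMat_eq (by omega)]
    exact posSemidef_pinv ((h𝒬 _ (by omega)).add (posSemidef_pinv
      (posSemidef_sigmaMat_of_psiMat hS ih)))

theorem posSemidef_sigmaMat (hS : (lyapunov A Qw Pbar - Pbar).PosSemidef)
    (h𝒬 : ∀ t, 1 ≤ t → (𝒬 t).PosSemidef) (t : ℕ) : (SigmaMat A Qw Pbar 𝒬 t).PosSemidef :=
  posSemidef_sigmaMat_of_psiMat hS (posSemidef_psiMat hS h𝒬 _)

/-- The factor `(det(Σ_t) det(Ψ_t⁻¹))^{-1/2}`. -/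
noncomputable def gaussianFactor (A Qw Pbar : Matrix (Fin n) (Fin n) ℝ)
    (𝒬 : ℕ → Matrix (Fin n) (Fin n) ℝ) (t : ℕ) : ℝ :=
  1 / Real.sqrt (pdet (SigmaMat A Qw Pbar 𝒬 t) * pdet (pinv (PsiMat A Qw Pbar 𝒬 t)))

theorem gaussianFactor_nonneg (t : ℕ) : 0 ≤ gaussianFactor A Qw Pbar 𝒬 t := by
  unfold gaussianFactor
  positivity

theorem tilt_sigmaMat (hS : (lyapunov A Qw Pbar - Pbar).PosSemidef)
    (h𝒬 : ∀ t, 1 ≤ t → (𝒬 t).PosSemidef)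
    (hΨ : ∀ t, 1 ≤ t → (SigmaMat A Qw Pbar 𝒬 t - PsiMat A Qw Pbar 𝒬 t).PosSemidef)
    {t : ℕ} (ht : 1 ≤ t) :
    (multivariateGaussian 0 (SigmaMat A Qw Pbar 𝒬 t)).withDensity
        (fun x => ENNReal.ofReal (Real.exp (-quadCost x (𝒬 t) / 2)))
      = ENNReal.ofReal (gaussianFactor A Qw Pbar 𝒬 t) •
        multivariateGaussian 0 (PsiMat A Qw Pbar 𝒬 t) := by
  have h := hΨ t ht
  rw [psiMat_eq ht] at h
  rw [gaussianFactor, psiMat_eq ht]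
  exact multivariateGaussian_tilt (posSemidef_sigmaMat hS h𝒬 t) (h𝒬 t ht) h

end Posterior

/-! ### The law of the incremental innovation given the remote information. -/

section ConditionalLaw

variable {n m : ℕ} {Ω : Type*}
  {x0 : Ω → EuclideanSpace ℝ (Fin n)} {w : ℕ → Ω → EuclideanSpace ℝ (Fin n)}
  {v : ℕ → Ω → EuclideanSpace ℝ (Fin m)} {y : ℕ → Ω → EuclideanSpace ℝ (Fin m)}
  {xs : ℕ → Ω → EuclideanSpace ℝ (Fin n)} {γ : ℕ → Ω → Fin 2}
  {A Qw Pbar : Matrix (Fin n) (Fin n) ℝ} {𝒬 : ℕ → Matrix (Fin n) (Fin n) ℝ}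
  {N₀ W α b : ℝ}

/-- The gain `N₀W/(2α)` cancels the channel exponent `α/(N₀W)` up to the `1/2` of a Gaussian
exponent. -/
theorem rpow_powerEF (hN₀ : 0 < N₀) (hW : 0 < W) (hα : 0 < α) (k : ℕ) (ω : Ω) :
    Real.exp (-α / (N₀ * W)) ^ powerEF A 𝒬 N₀ W α b xs γ k ω
      = Real.exp (-(α / (N₀ * W)) * b) *
        Real.exp (-quadCost (innovation A xs γ k ω) (𝒬 (holdingTime γ k ω)) / 2) := by
  rw [← Real.exp_mul, ← Real.exp_add, powerEF]
  congr 1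
  field_simp
  ring

variable [mΩ : MeasurableSpace Ω] {P : Measure Ω} [IsProbabilityMeasure P]

/-- The law of the incremental innovation on the event that the packet is dropped. -/
theorem map_innovation_drop (hN₀ : 0 < N₀) (hW : 0 < W) (hα : 0 < α)
    (hγ : IsChannel P x0 w v N₀ W α (powerEF A 𝒬 N₀ W α b xs γ) γ)
    (hpast : ∀ k, pastSigma x0 w v γ k ≤ mΩ)
    (hobs : ∀ N k, obsSigma y γ N k ≤ pastSigma x0 w v γ k)
    (hxs : ∀ k, Measurable[measurementSigma y k] (xs k))
    (hS : (lyapunov A Qw Pbar - Pbar).PosSemidef) (h𝒬 : ∀ t, 1 ≤ t → (𝒬 t).PosSemidef)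
    (hΨ : ∀ t, 1 ≤ t → (SigmaMat A Qw Pbar 𝒬 t - PsiMat A Qw Pbar 𝒬 t).PosSemidef)
    {k t : ℕ} (hk : 1 ≤ k) (ht : 1 ≤ t) {B : Set Ω} (hB : MeasurableSet[pastSigma x0 w v γ k] B)
    (hBt : ∀ ω ∈ B, holdingTime γ k ω = t)
    (hlaw : (P.restrict B).map (innovation A xs γ k)
      = P B • multivariateGaussian 0 (SigmaMat A Qw Pbar 𝒬 t)) :
    (P.restrict (B ∩ {ω | γ k ω = 0})).map (innovation A xs γ k)
      = (ENNReal.ofReal (gaussianFactor A Qw Pbar 𝒬 t * Real.exp (-(α / (N₀ * W)) * b)) * P B) •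
        multivariateGaussian 0 (PsiMat A Qw Pbar 𝒬 t) := by
  have hε : Measurable[pastSigma x0 w v γ k] (innovation A xs γ k) :=
    measurable_innovation
      (fun j hj => (measurable_estimate_obsSigma hxs hj).mono (hobs k k) le_rfl)
      (fun j hj => (measurable_arrival_obsSigma y hj).mono (hobs k k) le_rfl)
  have hε' : Measurable (innovation A xs γ k) := hε.mono (hpast k) le_rfl
  have hd : Measurable fun x : EuclideanSpace ℝ (Fin n) =>
      ENNReal.ofReal (Real.exp (-quadCost x (𝒬 t) / 2)) := by fun_prop
  have hdε : Measurable fun ω =>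
      ENNReal.ofReal (Real.exp (-quadCost (innovation A xs γ k ω) (𝒬 t) / 2)) := hd.comp hε'
  -- A drop reweights the law of `ε_k` by its conditional drop probability, which on `B` is a
  -- function of `ε_k` alone because `τ(k) = t` there.
  have hmain : (P.restrict (B ∩ {ω | γ k ω = 0})).map (innovation A xs γ k)
      = ENNReal.ofReal (Real.exp (-(α / (N₀ * W)) * b)) •
        ((P.restrict B).map (innovation A xs γ k)).withDensity
          (fun x => ENNReal.ofReal (Real.exp (-quadCost x (𝒬 t) / 2))) := by
    ext T hT
    rw [Measure.map_apply hε' hT, Measure.restrict_apply (hε' hT), Measure.smul_apply,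
      withDensity_apply _ hT, setLIntegral_map hT hd hε', smul_eq_mul,
      Measure.restrict_restrict (hε' hT), ← Set.inter_assoc,
      measure_inter_drop hγ hk (hpast k) ((hε hT).inter hB),
      ← lintegral_const_mul _ hdε]
    refine setLIntegral_congr_fun ((hε' hT).inter (hpast k _ hB)) fun ω hω => ?_
    rw [rpow_powerEF hN₀ hW hα, ENNReal.ofReal_mul (Real.exp_nonneg _), hBt ω hω.2]
  rw [hmain, hlaw, withDensity_smul_measure, tilt_sigmaMat hS h𝒬 hΨ ht, smul_smul, smul_smul,
    ENNReal.ofReal_mul (gaussianFactor_nonneg t)]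
  congr 1
  ring

/-- If the last packet has been received, then the incremental innovation is the innovation of the
local filter. -/
theorem map_innovation_restrict_of_arrival
    (hγ : IsChannel P x0 w v N₀ W α (powerEF A 𝒬 N₀ W α b xs γ) γ)
    (hpast : ∀ k, pastSigma x0 w v γ k ≤ mΩ)
    (hobs : ∀ N k, obsSigma y γ N k ≤ pastSigma x0 w v γ k)
    (hxs : ∀ k, Measurable[measurementSigma y k] (xs k)) {k : ℕ}
    (hlaw : P.map (stepInnovation A xs k)
      = multivariateGaussian 0 (lyapunov A Qw Pbar - Pbar))
    (hind : Indep (MeasurableSpace.comap (stepInnovation A xs k) inferInstance)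
      (measurementSigma y k) P) {B : Set Ω} (hB : MeasurableSet[infoSigma xs γ k] B)
    (hB1 : ∀ ω ∈ B, holdingTime γ (k + 1) ω = 1) :
    (P.restrict B).map (innovation A xs γ (k + 1))
      = P B • multivariateGaussian 0 (lyapunov A Qw Pbar - Pbar) := by
  have hγ1 : ∀ ω ∈ B, γ k ω = 1 := by
    intro ω hω
    by_contra h
    rcases Nat.eq_zero_or_pos k with rfl | hk
    · exact h (hγ.initial ω)
    · obtain ⟨j, rfl⟩ : ∃ j, k = j + 1 := ⟨k - 1, by omega⟩
      have h1 := hB1 ω hω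
      have h2 := holdingTime_pos γ j ω
      rw [holdingTime_succ_of_ne_one h] at h1
      omega
  have hB' := infoSigma_le_obsSigma hxs k B hB
  have hBm : MeasurableSet B := hpast _ _ (hobs _ _ _ hB')
  have hZ : Measurable (stepInnovation A xs k) := measurable_stepInnovation fun j hj =>
    (measurable_estimate_obsSigma (γ := γ) (k := 0) hxs hj).mono
      ((hobs (k + 1) 0).trans (hpast 0)) le_rfl
  rw [Measure.map_congr (ae_restrict_of_forall_mem hBm
    fun ω hω => innovation_succ_of_eq_one (hγ1 ω hω)), map_restrict_of_indep hZ hB'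
    (indep_stepInnovation_obsSigma hγ hpast hobs hxs hind (k + 1) le_rfl), hlaw]

/-- Given the information of the remote estimator, the incremental innovation is Gaussian with
covariance `Σ_τ`, where `τ` is the holding time. -/
theorem map_innovation_restrict (hN₀ : 0 < N₀) (hW : 0 < W) (hα : 0 < α)
    (hγ : IsChannel P x0 w v N₀ W α (powerEF A 𝒬 N₀ W α b xs γ) γ)
    (hpast : ∀ k, pastSigma x0 w v γ k ≤ mΩ)
    (hobs : ∀ N k, obsSigma y γ N k ≤ pastSigma x0 w v γ k)
    (hxs : ∀ k, Measurable[measurementSigma y k] (xs k))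
    (hS : (lyapunov A Qw Pbar - Pbar).PosSemidef) (h𝒬 : ∀ t, 1 ≤ t → (𝒬 t).PosSemidef)
    (hΨ : ∀ t, 1 ≤ t → (SigmaMat A Qw Pbar 𝒬 t - PsiMat A Qw Pbar 𝒬 t).PosSemidef)
    (hlaw : ∀ N, P.map (stepInnovation A xs N)
      = multivariateGaussian 0 (lyapunov A Qw Pbar - Pbar))
    (hind : ∀ N, Indep (MeasurableSpace.comap (stepInnovation A xs N) inferInstance)
      (measurementSigma y N) P) (k t : ℕ) {B : Set Ω} (hB : MeasurableSet[infoSigma xs γ k] B)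
    (hBt : ∀ ω ∈ B, holdingTime γ (k + 1) ω = t) :
    (P.restrict B).map (innovation A xs γ (k + 1))
      = P B • multivariateGaussian 0 (SigmaMat A Qw Pbar 𝒬 t) := by
  have hone : ∀ k (B : Set Ω), MeasurableSet[infoSigma xs γ k] B →
      (∀ ω ∈ B, holdingTime γ (k + 1) ω = 1) → (P.restrict B).map (innovation A xs γ (k + 1))
        = P B • multivariateGaussian 0 (SigmaMat A Qw Pbar 𝒬 1) := fun k B hB hB1 => by
    have h1 : SigmaMat A Qw Pbar 𝒬 1 = lyapunov A Qw Pbar - Pbar := by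
      simp [SigmaMat, PsiMat]
    rw [h1]
    exact map_innovation_restrict_of_arrival hγ hpast hobs hxs (hlaw k) (hind k) hB hB1
  induction k generalizing t B with
  | zero =>
    obtain rfl | ⟨ω, hω⟩ := B.eq_empty_or_nonempty
    · simp
    · obtain rfl : 1 = t :=
        (holdingTime_succ_of_eq_one (hγ.initial ω)).symm.trans (hBt ω hω)
      exact hone 0 B hB hBt
  | succ k ih =>
    by_cases ht1 : t = 1
    · subst ht1
      exact hone (k + 1) B hB hBt
    have hne : ∀ ω ∈ B, γ (k + 1) ω ≠ 1 := fun ω hω h =>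
      ht1 ((hBt ω hω).symm.trans (holdingTime_succ_of_eq_one h))
    obtain rfl | ⟨ω₀, hω₀⟩ := B.eq_empty_or_nonempty
    · simp
    obtain ⟨s, rfl⟩ : ∃ s, t = s + 1 :=
      ⟨_, (hBt ω₀ hω₀).symm.trans (holdingTime_succ_of_ne_one (hne ω₀ hω₀))⟩
    have hBs : ∀ ω ∈ B, holdingTime γ (k + 1) ω = s := fun ω hω => by
      have := hBt ω hω
      rw [holdingTime_succ_of_ne_one (hne ω hω)] at this
      omega
    have hs : 1 ≤ s := hBs ω₀ hω₀ ▸ holdingTime_pos γ k ω₀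
    have hBD := hB
    rw [infoSigma_succ] at hBD
    -- On a drop both `γ_{k+1}` and `γ_{k+1} x̂_{k+1}` are zero, so `B` is cut out of the drop event
    -- by an event of `I_k`.
    obtain ⟨D, hD, hDB⟩ := exists_measurableSet_inter_eq (S := {ω | γ (k + 1) ω = 0})
      (fun ω h ω' h' => by
        rw [Set.mem_ofPred_eq] at h h'
        simp [h, h']) hBD
    have hDm : MeasurableSet[infoSigma xs γ k] (D ∩ {ω | holdingTime γ (k + 1) ω = s}) :=
      hD.inter (measurable_holdingTime_infoSigma hγ.initial k (measurableSet_singleton s))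
    have hBeq : B = D ∩ {ω | holdingTime γ (k + 1) ω = s} ∩ {ω | γ (k + 1) ω = 0} := by
      ext ω
      have h1 := Set.ext_iff.1 hDB ω
      have h2 : ω ∈ B → γ (k + 1) ω = 0 := fun h => by
        by_contra h3
        exact hne ω h (Fin.eq_one_of_ne_zero _ h3)
      have h3 := hBs ω
      have h4 : holdingTime γ (k + 1) ω = s → γ (k + 1) ω = 0 → ω ∈ D → ω ∈ B :=
        fun _ h5 h6 => (h1.2 ⟨h6, h5⟩).1
      simp only [Set.mem_inter_iff, Set.mem_ofPred_eq] at h1 ⊢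
      tauto
    have hdrop := map_innovation_drop hN₀ hW hα hγ hpast hobs hxs hS h𝒬 hΨ
      (Nat.le_add_left 1 k) hs
      ((hobs _ _).trans' (infoSigma_le_obsSigma hxs k) _ hDm) (fun ω hω => hω.2)
      (ih s hDm fun ω hω => hω.2)
    rw [← hBeq] at hdrop
    have hX : Measurable[obsSigma y γ (k + 1) (k + 2)] (innovation A xs γ (k + 1)) :=
      measurable_innovation (fun j hj => measurable_estimate_obsSigma hxs hj)
        fun j hj => measurable_arrival_obsSigma y (by omega)
    have hM : obsSigma y γ (k + 1) (k + 2) ≤ mΩ := (hobs _ _).trans (hpast _)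
    have hZ : Measurable (stepInnovation A xs (k + 1)) := measurable_stepInnovation fun j hj =>
      (measurable_estimate_obsSigma (γ := γ) (k := 0) hxs hj).mono
        ((hobs _ 0).trans (hpast 0)) le_rfl
    have hBo := infoSigma_le_obsSigma hxs (k + 1) B hB
    -- Comparing total masses identifies the coefficient in `hdrop` as `P B`, so the law of the
    -- previous `ε` on `B` is `N(0, Ψ_s)` up to that mass.
    have hmass := congrArg (fun μ => μ Set.univ) hdrop
    simp only [Measure.map_apply (hX.mono hM le_rfl) MeasurableSet.univ, Set.preimage_univ,
      Measure.restrict_apply_univ, Measure.smul_apply, measure_univ, smul_eq_mul, mul_one] at hmass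
    rw [← hmass] at hdrop
    have hA : Measurable fun p : EuclideanSpace ℝ (Fin n) × EuclideanSpace ℝ (Fin n) =>
        toEuclideanLin A p.1 + p.2 :=
      ((toEuclideanLin A).toContinuousLinearMap.measurable.comp measurable_fst).add measurable_snd
    rw [Measure.map_congr (ae_restrict_of_forall_mem (hM B hBo)
      fun ω hω => innovation_succ_of_ne_one (hne ω hω)),
      show (fun ω => toEuclideanLin A (innovation A xs γ (k + 1) ω) +
          stepInnovation A xs (k + 1) ω)
        = (fun p : EuclideanSpace ℝ (Fin n) × EuclideanSpace ℝ (Fin n) =>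
            toEuclideanLin A p.1 + p.2) ∘
          fun ω => (innovation A xs γ (k + 1) ω, stepInnovation A xs (k + 1) ω) from rfl,
      ← Measure.map_map hA ((hX.mono hM le_rfl).prodMk hZ),
      map_restrict_prod_of_indep hM hX hZ hBo
        (indep_stepInnovation_obsSigma hγ hpast hobs hxs (hind (k + 1)) (k + 2) le_rfl),
      hdrop, hlaw, Measure.prod_smul_left, Measure.map_smul,
      map_prod_multivariateGaussian (posSemidef_psiMat hS h𝒬 s) hS]
    rfl

/-- The probability of a drop on an event known to the remote estimator. -/
theorem measure_inter_drop_infoSigma (hN₀ : 0 < N₀) (hW : 0 < W) (hα : 0 < α)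
    (hγ : IsChannel P x0 w v N₀ W α (powerEF A 𝒬 N₀ W α b xs γ) γ)
    (hpast : ∀ k, pastSigma x0 w v γ k ≤ mΩ)
    (hobs : ∀ N k, obsSigma y γ N k ≤ pastSigma x0 w v γ k)
    (hxs : ∀ k, Measurable[measurementSigma y k] (xs k))
    (hS : (lyapunov A Qw Pbar - Pbar).PosSemidef) (h𝒬 : ∀ t, 1 ≤ t → (𝒬 t).PosSemidef)
    (hΨ : ∀ t, 1 ≤ t → (SigmaMat A Qw Pbar 𝒬 t - PsiMat A Qw Pbar 𝒬 t).PosSemidef)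
    (hlaw : ∀ N, P.map (stepInnovation A xs N)
      = multivariateGaussian 0 (lyapunov A Qw Pbar - Pbar))
    (hind : ∀ N, Indep (MeasurableSpace.comap (stepInnovation A xs N) inferInstance)
      (measurementSigma y N) P) (k t : ℕ) {B : Set Ω} (hB : MeasurableSet[infoSigma xs γ k] B)
    (hBt : ∀ ω ∈ B, holdingTime γ (k + 1) ω = t) :
    P (B ∩ {ω | γ (k + 1) ω = 0})
      = ENNReal.ofReal (gaussianFactor A Qw Pbar 𝒬 t * Real.exp (-(α / (N₀ * W)) * b)) *
        P B := by
  obtain rfl | ⟨ω₀, hω₀⟩ := B.eq_empty_or_nonempty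
  · simp
  have ht : 1 ≤ t := hBt ω₀ hω₀ ▸ holdingTime_pos γ k ω₀
  have hε : Measurable (innovation A xs γ (k + 1)) :=
    (measurable_innovation (fun j hj => measurable_estimate_obsSigma hxs hj)
      fun j hj => measurable_arrival_obsSigma y hj).mono ((hobs (k + 1) (k + 1)).trans (hpast _))
      le_rfl
  have hdrop := map_innovation_drop hN₀ hW hα hγ hpast hobs hxs hS h𝒬 hΨ
    (Nat.le_add_left 1 k) ht
    ((hobs _ _).trans' (infoSigma_le_obsSigma hxs k) _ hB) hBt
    (map_innovation_restrict hN₀ hW hα hγ hpast hobs hxs hS h𝒬 hΨ hlaw hind k t hB hBt)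
  -- Here the total mass itself is the assertion.
  have hmass := congrArg (fun μ => μ Set.univ) hdrop
  simpa only [Measure.map_apply hε MeasurableSet.univ, Set.preimage_univ,
    Measure.restrict_apply_univ, Measure.smul_apply, measure_univ, smul_eq_mul, mul_one] using hmass

end ConditionalLaw

end RemoteEstimation

namespace RemoteEstimation

/-! ### Assembly of the conditional probability. -/

section Main

variable {n m : ℕ} {Ω : Type*}
  {x0 : Ω → EuclideanSpace ℝ (Fin n)} {w : ℕ → Ω → EuclideanSpace ℝ (Fin n)}
  {v : ℕ → Ω → EuclideanSpace ℝ (Fin m)} {y : ℕ → Ω → EuclideanSpace ℝ (Fin m)}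
  {xs : ℕ → Ω → EuclideanSpace ℝ (Fin n)} {γ : ℕ → Ω → Fin 2}
  {A Qw Pbar : Matrix (Fin n) (Fin n) ℝ} {𝒬 : ℕ → Matrix (Fin n) (Fin n) ℝ}
  {N₀ W α b : ℝ}

/-- The measurements are functions of the initial state and the noises. -/
theorem obsSigma_le_pastSigma (A : Matrix (Fin n) (Fin n) ℝ) (C : Matrix (Fin m) (Fin n) ℝ)
    (x0 : Ω → EuclideanSpace ℝ (Fin n)) (w : ℕ → Ω → EuclideanSpace ℝ (Fin n))
    (v : ℕ → Ω → EuclideanSpace ℝ (Fin m)) (γ : ℕ → Ω → Fin 2) (N k : ℕ) :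
    obsSigma (measurement A C x0 w v) γ N k ≤ pastSigma x0 w v γ k := by
  have hx0 : Measurable[pastSigma x0 w v γ k] x0 :=
    measurable_iff_comap_le.2 (le_sup_left.trans (le_sup_left.trans le_sup_left))
  have hw : ∀ j, Measurable[pastSigma x0 w v γ k] (w j) := fun j =>
    measurable_iff_comap_le.2 ((le_iSup (fun j => MeasurableSpace.comap (w j) inferInstance)
      j).trans (le_sup_right.trans (le_sup_left.trans le_sup_left)))
  have hv : ∀ j, Measurable[pastSigma x0 w v γ k] (v j) := fun j =>
    measurable_iff_comap_le.2 ((le_iSup (fun j => MeasurableSpace.comap (v j) inferInstance)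
      j).trans (le_sup_right.trans le_sup_left))
  have hx : ∀ j, Measurable[pastSigma x0 w v γ k] (state A x0 w j) := fun j => by
    induction j with
    | zero => exact hx0
    | succ j ih =>
      exact ((toEuclideanLin A).toContinuousLinearMap.measurable.comp ih).add (hw j)
  refine sup_le (iSup₂_le fun j _ => Measurable.comap_le ?_) le_sup_right
  exact ((toEuclideanLin C).toContinuousLinearMap.measurable.comp (hx j)).add (hv j)

variable [mΩ : MeasurableSpace Ω] {P : Measure Ω}

theorem pastSigma_le {P0 : Matrix (Fin n) (Fin n) ℝ} {R : Matrix (Fin m) (Fin m) ℝ}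
    {p : ℕ → Ω → ℝ} (hplant : IsGaussianPlant P P0 Qw R x0 w v)
    (hγ : IsChannel P x0 w v N₀ W α p γ) (k : ℕ) : pastSigma x0 w v γ k ≤ mΩ :=
  sup_le (sup_le (sup_le hplant.measurable_init.comap_le
    (iSup_le fun j => (hplant.measurable_state j).comap_le))
    (iSup_le fun j => (hplant.measurable_obs j).comap_le))
    (iSup₂_le fun j _ => (hγ.measurable j).comap_le)

/-- The conditional probability of a drop, given the information of the remote estimator. -/
theorem condExp_drop_infoSigma [IsProbabilityMeasure P] (hN₀ : 0 < N₀) (hW : 0 < W) (hα : 0 < α)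
    (hγ : IsChannel P x0 w v N₀ W α (powerEF A 𝒬 N₀ W α b xs γ) γ)
    (hpast : ∀ k, pastSigma x0 w v γ k ≤ mΩ)
    (hobs : ∀ N k, obsSigma y γ N k ≤ pastSigma x0 w v γ k)
    (hxs : ∀ k, Measurable[measurementSigma y k] (xs k))
    (hS : (lyapunov A Qw Pbar - Pbar).PosSemidef) (h𝒬 : ∀ t, 1 ≤ t → (𝒬 t).PosSemidef)
    (hΨ : ∀ t, 1 ≤ t → (SigmaMat A Qw Pbar 𝒬 t - PsiMat A Qw Pbar 𝒬 t).PosSemidef)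
    (hlaw : ∀ N, P.map (stepInnovation A xs N)
      = multivariateGaussian 0 (lyapunov A Qw Pbar - Pbar))
    (hind : ∀ N, Indep (MeasurableSpace.comap (stepInnovation A xs N) inferInstance)
      (measurementSigma y N) P) (k : ℕ) :
    P⟦{ω | γ (k + 1) ω = 0} | infoSigma xs γ k⟧ =ᵐ[P] fun ω =>
      gaussianFactor A Qw Pbar 𝒬 (holdingTime γ (k + 1) ω) *
        Real.exp (-(α / (N₀ * W)) * b) := by
  have hinfo : infoSigma xs γ k ≤ mΩ :=
    (infoSigma_le_obsSigma hxs k).trans ((hobs _ _).trans (hpast _))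
  have hτ := measurable_holdingTime_infoSigma (xs := xs) hγ.initial k
  have hm : MeasurableSet {ω | γ (k + 1) ω = 0} :=
    hγ.measurable (k + 1) (measurableSet_singleton 0)
  have hc : ∀ t, 0 ≤ gaussianFactor A Qw Pbar 𝒬 t * Real.exp (-(α / (N₀ * W)) * b) := fun t =>
    mul_nonneg (gaussianFactor_nonneg t) (Real.exp_nonneg _)
  have hg : Measurable[infoSigma xs γ k] fun ω =>
      gaussianFactor A Qw Pbar 𝒬 (holdingTime γ (k + 1) ω) *
        Real.exp (-(α / (N₀ * W)) * b) :=
    (measurable_of_countable fun t : ℕ =>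
      gaussianFactor A Qw Pbar 𝒬 t * Real.exp (-(α / (N₀ * W)) * b)).comp hτ
  have hgi : Integrable (fun ω => gaussianFactor A Qw Pbar 𝒬 (holdingTime γ (k + 1) ω) *
      Real.exp (-(α / (N₀ * W)) * b)) P := by
    -- The holding time is at most `k + 1`, so the sum of the finitely many possible nonnegative
    -- values is a bound.
    refine Integrable.of_bound (hg.mono hinfo le_rfl).aestronglyMeasurable
      (∑ t ∈ Finset.range (k + 2),
        gaussianFactor A Qw Pbar 𝒬 t * Real.exp (-(α / (N₀ * W)) * b)) (ae_of_all _ fun ω => ?_)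
    rw [Real.norm_of_nonneg (hc _)]
    exact Finset.single_le_sum (f := fun t =>
      gaussianFactor A Qw Pbar 𝒬 t * Real.exp (-(α / (N₀ * W)) * b)) (fun t _ => hc t)
      (Finset.mem_range.2 (Nat.lt_succ_of_le (holdingTime_le γ (k + 1) ω)))
  have hint : Integrable ({ω | γ (k + 1) ω = 0}.indicator fun _ => (1 : ℝ)) P :=
    (integrable_const 1).indicator hm
  refine (ae_eq_condExp_of_forall_setIntegral_eq hinfo hint
    (fun _ _ _ => hgi.integrableOn) (fun B hB _ => ?_) hg.aestronglyMeasurable).symm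
  have hBt : ∀ t, MeasurableSet[infoSigma xs γ k] (B ∩ {ω | holdingTime γ (k + 1) ω = t}) :=
    fun t => hB.inter (hτ (measurableSet_singleton t))
  -- Slicing by the holding time, which is known to the remote estimator, makes the candidate
  -- constant on each slice.
  have hU : B = ⋃ t, B ∩ {ω | holdingTime γ (k + 1) ω = t} := by
    ext ω
    simp
  have hdisj : Pairwise (Function.onFun Disjoint
      fun t => B ∩ {ω | holdingTime γ (k + 1) ω = t}) := fun s t hst =>
    Set.disjoint_left.2 fun ω h1 h2 => hst (h1.2.symm.trans h2.2)
  rw [hU, integral_iUnion (fun t => hinfo _ (hBt t)) hdisj hgi.integrableOn,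
    integral_iUnion (fun t => hinfo _ (hBt t)) hdisj hint.integrableOn]
  refine tsum_congr fun t => ?_
  have hdrop := measure_inter_drop_infoSigma hN₀ hW hα hγ hpast hobs hxs hS h𝒬 hΨ hlaw hind k t
    (hBt t) fun ω hω => hω.2
  rw [setIntegral_congr_fun (g := fun _ => gaussianFactor A Qw Pbar 𝒬 t *
    Real.exp (-(α / (N₀ * W)) * b)) (hinfo _ (hBt t)) fun ω hω => by simp only [hω.2.out],
    setIntegral_indicator hm, setIntegral_const, setIntegral_const, smul_eq_mul, smul_eq_mul,
    mul_one, measureReal_def, measureReal_def, hdrop, ENNReal.toReal_mul,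
    ENNReal.toReal_ofReal (hc t), mul_comm]

end Main

end RemoteEstimation
theorem mainTheorem4 {n m : ℕ} {Ω : Type*} [MeasurableSpace Ω] (P : Measure Ω)
    [IsProbabilityMeasure P]
    (A Qw P0 Pbar : Matrix (Fin n) (Fin n) ℝ) (C : Matrix (Fin m) (Fin n) ℝ)
    (R : Matrix (Fin m) (Fin m) ℝ)
    (x0 : Ω → EuclideanSpace ℝ (Fin n)) (w : ℕ → Ω → EuclideanSpace ℝ (Fin n))
    (v : ℕ → Ω → EuclideanSpace ℝ (Fin m))
    (hplant : RemoteEstimation.IsGaussianPlant P P0 Qw R x0 w v)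
    (x : ℕ → Ω → EuclideanSpace ℝ (Fin n)) (hx : x = RemoteEstimation.state A x0 w)
    (y : ℕ → Ω → EuclideanSpace ℝ (Fin m)) (hy : y = RemoteEstimation.measurement A C x0 w v)
    (hsteady : RemoteEstimation.IsSteadyState P x y Pbar)
    (xs : ℕ → Ω → EuclideanSpace ℝ (Fin n)) (hxs : xs = RemoteEstimation.localEstimate P x y)
    (N₀ W α b : ℝ) (hN₀ : 0 < N₀) (hW : 0 < W) (hα : 0 < α) (hα1 : α ≤ 1) (hb : 0 ≤ b)
    (𝒬 : ℕ → Matrix (Fin n) (Fin n) ℝ) (h𝒬 : ∀ t, 1 ≤ t → (𝒬 t).PosSemidef)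
    (hΨ : ∀ t, 1 ≤ t → (RemoteEstimation.SigmaMat A Qw Pbar 𝒬 t -
      RemoteEstimation.PsiMat A Qw Pbar 𝒬 t).PosSemidef)
    (γ : ℕ → Ω → Fin 2)
    (hγ : RemoteEstimation.IsChannel P x0 w v N₀ W α
      (RemoteEstimation.powerEF A 𝒬 N₀ W α b xs γ) γ)
    (k : ℕ) (hk : 1 ≤ k) :
    P⟦{ω | γ k ω = 0} | RemoteEstimation.infoSigma xs γ (k - 1)⟧ =ᵐ[P] fun ω =>
      1 / Real.sqrt
          (RemoteEstimation.pdet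
              (RemoteEstimation.SigmaMat A Qw Pbar 𝒬 (RemoteEstimation.holdingTime γ k ω)) *
            RemoteEstimation.pdet (RemoteEstimation.pinv
              (RemoteEstimation.PsiMat A Qw Pbar 𝒬 (RemoteEstimation.holdingTime γ k ω)))) *
        Real.exp (-(α / (N₀ * W)) * b) := by
  subst hx hy hxs
  have hest : ∀ k, Measurable[RemoteEstimation.measurementSigma
      (RemoteEstimation.measurement A C x0 w v) k] (RemoteEstimation.localEstimate P
        (RemoteEstimation.state A x0 w) (RemoteEstimation.measurement A C x0 w v) k) :=
    fun k => stronglyMeasurable_condExp.measurable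
  have hpast := RemoteEstimation.pastSigma_le hplant hγ
  have hobs := RemoteEstimation.obsSigma_le_pastSigma A C x0 w v γ
  -- The conditional law is indexed by the information time `j = k - 1`.
  obtain ⟨j, rfl⟩ : ∃ j, k = j + 1 := ⟨k - 1, by omega⟩
  exact RemoteEstimation.condExp_drop_infoSigma hN₀ hW hα hγ hpast hobs hest
    (RemoteEstimation.innovation_law hplant hsteady 0).1 h𝒬 hΨ
    (fun N => (RemoteEstimation.innovation_law hplant hsteady N).2.1)
    (fun N => (RemoteEstimation.innovation_law hplant hsteady N).2.2) j
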